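/- Let $n\ge 0$, let $X$ be a finite multiset of nonzero vectors of $\mathbb R^n$ that spans $\mathbb R^n$, and let $B_0$ be an ordered basis of $\mathbb R^n$. Put $X'=X\cup B_0$ (multiset union); subsets of $X$ and $X'$ are understood as sub-multisets, with repeated vectors distinguished. *Polynomials.* Let $\Pi=\mathbb C[t_1,\dots,t_n]$. For $p\in\Pi$ put $p(D)=p(\partial/\partial t_1,\dots,\partial/\partial t_n)$, and for a polynomial or formal power series $f$ let $\langle p,f\rangle=(p(D)f)(0)$. For $x\in\mathbb R^n$ let $p_x(t)=x\cdot t$, and let $p_Y=\prod_{y\in Y}p_y$ for a multiset $Y$ of vectors. For $\alpha\in\mathbb C^n$ let $e_\alpha$ be the power series of $t\mapsto e^{\alpha\cdot t}$. For an ideal $I\subset\Pi$, $\ker I$ is the span, in $\mathbb C[[t_1,\dots,t_n]]$, of all $e_\alpha p$ with $\alpha\in\mathbb C^n$ a common zero of $I$ and $p\in\Pi$ such that $\langle q,e_\alpha p\rangle=0$ for all $q\in I$. For a finite set $\sigma\subset\mathbb C^n$, $\Pi(\sigma)=\operatorname{span}\{f_\downarrow : f\in\operatorname{span}\{e_\alpha:\alpha\in\sigma\}\}$,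 where $f_\downarrow$ is the nonzero homogeneous component of $f$ of least degree ($0_\downarrow=0$). The set $\sigma$ is correct for a subspace $P\subset\Pi$ if $p\mapsto p|_\sigma$ is a bijection from $P$ onto $\mathbb C^\sigma$. *External bases.* Let $\mathbb I(X)$ be the set of linearly independent subsets of $X$ (including $\emptyset$). For $I\in\mathbb I(X)$ let $\mathrm{ex}(I)\subset X'$ consist of $I$ and of those $b\in B_0$ with $b\notin\operatorname{span}(I\cup\{b'\in B_0: b'\prec b\})$, where $\prec$ is the order of $B_0$; this is a basis of $\mathbb R^n$. Let $\mathbb B_+(X)=\{\mathrm{ex}(I): I\in\mathbb I(X)\}$ and $L_+(X)=\{Y\subset X': Y\cap B\ne\emptyset \text{ for all } B\in\mathbb B_+(X)\}$. *Spaces and ideals.* Let $$\mathcal P_+(X)=\operatorname{span}\{p_Y:Y\subset X\},\qquad \mathcal D_+(X)=\{f\in\Pi: p_Y(D)f=0\ \text{ for all } Y\in L_+(X)\},$$ let $\mathcal J_+(X)$ be the ideal generated by $\{p_Y:Y\in L_+(X)\}$, and let $\mathcal I_+(X)$ be the ideal generated by all $p_{\eta}^{m(H)+1}$, where $H$ runs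 over the $(n-1)$-dimensional subspaces of $\mathbb R^n$ spanned by $X\cap H$, $\eta$ is a nonzero normal of $H$, and $m(H)=\#(X\setminus H)$. *Vertices.* For $\lambda\in\mathbb R^{X'}$ let $H_{x,\lambda}=\{t\in\mathbb R^n: x\cdot t=\lambda_x\}$, $x\in X'$. Call $\lambda$ generic if no $n+1$ of these hyperplanes (indexed by distinct members of $X'$) have a common point. Let $V_+(X,\lambda)\subset\mathbb R^n\subset\mathbb C^n$ be the set of the points $v_B$, $B\in\mathbb B_+(X)$, where $v_B$ is the common point of the $H_{x,\lambda}$, $x\in B$. **Theorem.** 1. $\dim\mathcal P_+(X)=\dim\mathcal D_+(X)=\#\mathbb I(X)$. 2. The map $p\mapsto\langle p,\cdot\rangle$ is a bijection from $\mathcal D_+(X)$ onto the dual space $\mathcal P_+(X)'$. 3. $\mathcal D_+(X)=\Pi(V_+(X,\lambda))$ for every generic $\lambda$, and $\mathcal D_+(X)=\ker\mathcal J_+(X)$. 4. For every generic $\lambda$, the set $V_+(X,\lambda)$ is correct for $\mathcal D_+(X)$ and for $\mathcal P_+(X)$. 5. $\mathcal P_+(X)=\ker\mathcal I_+(X)$.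 6. $\Pi=\mathcal P_+(X)\oplus\mathcal J_+(X)$. -/

import Mathlib

namespace Zonotopal

noncomputable section

/-! ## Polynomials, power series, differential operators -/

/-- The space of complex polynomials in `n` variables. -/
abbrev Poly (n : ℕ) : Type := MvPolynomial (Fin n) ℂ

/-- Formal power series in `n` variables over the complex numbers. -/
abbrev Series (n : ℕ) : Type := MvPowerSeries (Fin n) ℂ

/-- The inclusion of polynomials into formal power series, as a linear map. -/
def toSeries (n : ℕ) : Poly n →ₗ[ℂ] Series n where
  toFun p := (p : MvPowerSeries (Fin n) ℂ)
  map_add' p q := MvPolynomial.coe_add p q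
  map_smul' c p := MvPolynomial.coe_smul p c

/-- `D^m`, that is `D_1 ^ m_1 ⋯ D_n ^ m_n`, acting on formal power series. -/
def monomialDiff {n : ℕ} (m : Fin n →₀ ℕ) : Module.End ℂ (Series n) :=
  ((List.finRange n).map fun i =>
    ((MvPowerSeries.pderiv ℂ i : Derivation ℂ (Series n) (Series n)) :
      Module.End ℂ (Series n)) ^ m i).prod

/-- The differential operator `p(D)` acting on formal power series, linearly in `p`:
the monomial `t^m` acts as `D^m`. -/
def diffOp (n : ℕ) : Poly n →ₗ[ℂ] Module.End ℂ (Series n) :=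
  (MvPolynomial.basisMonomials (Fin n) ℂ).constr ℂ monomialDiff

/-- The pairing `⟨p, f⟩ = (p(D) f)(0)` of a polynomial `p` with a formal power series `f`. -/
def pairing {n : ℕ} (p : Poly n) : Series n →ₗ[ℂ] ℂ :=
  MvPowerSeries.coeff (R := ℂ) (0 : Fin n →₀ ℕ) ∘ₗ diffOp n p

/-- The pairing of two polynomial subspaces, as a map from `D` to the dual of `P`:
it sends `p` to the functional `f ↦ ⟨p, f⟩`. -/
def pairingMap {n : ℕ} (D P : Submodule ℂ (Poly n)) (p : D) : Module.Dual ℂ P :=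
  pairing (p : Poly n) ∘ₗ toSeries n ∘ₗ P.subtype

/-- The power series of the exponential `t ↦ exp (α ⋅ t)`. -/
def expSeries {n : ℕ} (α : Fin n → ℂ) : Series n :=
  fun m => ∏ i, α i ^ m i / ((m i).factorial : ℂ)

/-- The nonzero homogeneous part of least degree of a power series, and `0` for the series `0`. -/
def leastTerm {n : ℕ} (f : Series n) : Poly n :=
  ∑ m ∈ Finset.finsuppAntidiag Finset.univ f.order.toNat,
    MvPolynomial.monomial m (MvPowerSeries.coeff m f)

/-- The exponential space of a point set. -/
def expSpace {n : ℕ} (σ : Set (Fin n → ℂ)) : Submodule ℂ (Series n) :=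
  Submodule.span ℂ (expSeries '' σ)

/-- The least space `Π(σ)` of a point set. -/
def leastSpace {n : ℕ} (σ : Set (Fin n → ℂ)) : Submodule ℂ (Poly n) :=
  Submodule.span ℂ (leastTerm '' (expSpace σ : Set (Series n)))

/-- A point set is correct for a polynomial space if restriction to the points is a bijection
from the space onto all complex functions on the point set. -/
def IsCorrect {n : ℕ} (σ : Set (Fin n → ℂ)) (P : Submodule ℂ (Poly n)) : Prop :=
  Function.Bijective fun (p : P) (α : σ) => MvPolynomial.eval (α : Fin n → ℂ) (p : Poly n)

/-- The kernel of an ideal: the span of all exponential polynomials `e_α p`, with `α` in the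
variety of the ideal and `p` a polynomial, that are orthogonal to the ideal. -/
def idealKer {n : ℕ} (I : Ideal (Poly n)) : Submodule ℂ (Series n) :=
  Submodule.span ℂ {g | ∃ α : Fin n → ℂ, (∀ q ∈ I, MvPolynomial.eval α q = 0) ∧
    ∃ p : Poly n, g = expSeries α * toSeries n p ∧ ∀ q ∈ I, pairing q g = 0}

/-! ## Products of linear forms -/

/-- The linear form `p_x : t ↦ x ⋅ t`. -/
def linForm {n : ℕ} (x : Fin n → ℝ) : Poly n :=
  ∑ i, MvPolynomial.C (x i : ℂ) * MvPolynomial.X i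

/-- The product `p_Y` of the linear forms of the members of the subfamily `Y` of `X`. -/
def prodForm {n : ℕ} {ι : Type*} (X : ι → Fin n → ℝ) (Y : Finset ι) : Poly n :=
  ∏ y ∈ Y, linForm (X y)

/-! ## Independent subsets and external bases

A finite multiset of vectors is a family `X : ι → Fin n → ℝ` with `ι` finite; its (multi)subsets
are the finite subsets of `ι`. -/

/-- The independent subsets of `X`. -/
def indepSets {n : ℕ} {ι : Type*} (X : ι → Fin n → ℝ) : Set (Finset ι) :=
  {I | LinearIndependent ℝ fun i : I => X i}

/-- The multiset `X' = X ∪ B₀`. The ordered basis `B₀` is ordered by its index set. -/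
def augmented {n : ℕ} {ι : Type*} (X : ι → Fin n → ℝ)
    (B₀ : Module.Basis (Fin n) ℝ (Fin n → ℝ)) : ι ⊕ Fin n → Fin n → ℝ :=
  Sum.elim X B₀

open Classical in
/-- The greedy completion `ex(I)` of `I` by elements of `B₀`. -/
def greedyExt {n : ℕ} {ι : Type*} (X : ι → Fin n → ℝ)
    (B₀ : Module.Basis (Fin n) ℝ (Fin n → ℝ)) (I : Finset ι) : Finset (ι ⊕ Fin n) :=
  I.disjSum (Finset.univ.filter fun k =>
    B₀ k ∉ Submodule.span ℝ (X '' (I : Set ι) ∪ B₀ '' {j | j < k}))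

/-- The external bases of `X`, as subsets of `X'`. -/
def externalBases {n : ℕ} {ι : Type*} (X : ι → Fin n → ℝ)
    (B₀ : Module.Basis (Fin n) ℝ (Fin n → ℝ)) : Set (Finset (ι ⊕ Fin n)) :=
  greedyExt X B₀ '' indepSets X

/-- `L_+(X)`: the subsets of `X'` that meet every external basis. -/
def externalLong {n : ℕ} {ι : Type*} (X : ι → Fin n → ℝ)
    (B₀ : Module.Basis (Fin n) ℝ (Fin n → ℝ)) : Set (Finset (ι ⊕ Fin n)) :=
  {Y | ∀ B ∈ externalBases X B₀, ∃ y ∈ Y, y ∈ B}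

/-! ## The external spaces and ideals -/

/-- `P_+(X)`: the span of all `p_Y`, `Y ⊆ X`. -/
def PPlus {n : ℕ} {ι : Type*} (X : ι → Fin n → ℝ) : Submodule ℂ (Poly n) :=
  Submodule.span ℂ (Set.range (prodForm X))

/-- `D_+(X)`: the polynomials annihilated by `p_Y(D)` for all `Y` in `L_+(X)`. -/
def DPlus {n : ℕ} {ι : Type*} (X : ι → Fin n → ℝ)
    (B₀ : Module.Basis (Fin n) ℝ (Fin n → ℝ)) : Submodule ℂ (Poly n) :=
  ⨅ Y ∈ externalLong X B₀,
    LinearMap.ker (diffOp n (prodForm (augmented X B₀) Y) ∘ₗ toSeries n)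

/-- `J_+(X)`: the ideal generated by all `p_Y`, `Y` in `L_+(X)`. -/
def JPlus {n : ℕ} {ι : Type*} (X : ι → Fin n → ℝ)
    (B₀ : Module.Basis (Fin n) ℝ (Fin n → ℝ)) : Ideal (Poly n) :=
  Ideal.span (prodForm (augmented X B₀) '' externalLong X B₀)

/-- The facet hyperplanes of `X`: the hyperplanes `H` through `0` spanned by `X ∩ H`. -/
def facetHyperplanes {n : ℕ} {ι : Type*} (X : ι → Fin n → ℝ) :
    Set (Submodule ℝ (Fin n → ℝ)) :=
  {H | Module.finrank ℝ H + 1 = n ∧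
    Submodule.span ℝ (Set.range X ∩ (H : Set (Fin n → ℝ))) = H}

/-- `m(H)`: the number of members of the multiset `X` that are not in `H`. -/
def outsideCount {n : ℕ} {ι : Type*} (X : ι → Fin n → ℝ)
    (H : Submodule ℝ (Fin n → ℝ)) : ℕ :=
  {i | X i ∉ H}.ncard

/-- `I_+(X)`: the ideal generated by the `p_η ^ (m(H) + 1)`, with `H` a facet hyperplane
and `η` a nonzero normal of `H`. -/
def IPlus {n : ℕ} {ι : Type*} (X : ι → Fin n → ℝ) : Ideal (Poly n) :=
  Ideal.span {p | ∃ H ∈ facetHyperplanes X, ∃ η : Fin n → ℝ, η ≠ 0 ∧ (∀ h ∈ H, η ⬝ᵥ h = 0) ∧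
    p = linForm η ^ (outsideCount X H + 1)}

/-! ## Hyperplane arrangements -/

/-- The parameters `lam` are generic for the arrangement of the hyperplanes
`{t | X i ⋅ t = lam i}` if no `n + 1` of these hyperplanes have a common point. -/
def IsGeneric {n : ℕ} {κ : Type*} (X : κ → Fin n → ℝ) (lam : κ → ℝ) : Prop :=
  ∀ S : Finset κ, S.card = n + 1 → ¬ ∃ v : Fin n → ℝ, ∀ y ∈ S, X y ⬝ᵥ v = lam y

/-- `V_+(X, lam)`: the vertices of the `X'`-arrangement that correspond to the external bases,
`B` corresponding to the common point of the hyperplanes of its members. They are real points,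
regarded as points of complex `n`-space. -/
def externalVertices {n : ℕ} {ι : Type*} (X : ι → Fin n → ℝ)
    (B₀ : Module.Basis (Fin n) ℝ (Fin n → ℝ)) (lam : ι ⊕ Fin n → ℝ) : Set (Fin n → ℂ) :=
  (fun (v : Fin n → ℝ) (i : Fin n) => (v i : ℂ)) ''
    {v | ∃ B ∈ externalBases X B₀, ∀ y ∈ B, augmented X B₀ y ⬝ᵥ v = lam y}

end

end Zonotopal

open Zonotopal

open Zonotopal

namespace Zonotopal

noncomputable section

open MvPolynomial

/-! ## The pairing -/

/-! The proof squeezes all dimensions between two copies of `#𝕀(X)`.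

Upper end: `dim P_+ = #𝕀(X)` by deletion and contraction (`finrank_prodSpan`). For `x ≠ 0`,
multiplication by `p_x` and a substitution killing `p_x` give an exact sequence `0 → P(S) → P(S ∪ x)
→ P(S / x) → 0`, matching the split of the independent sets into those without and with `x`.
Exactness in the middle is the hard point: if `p_x q` is a combination of products, why is `q` one?
It is settled by describing the span as a space of polynomials of bounded degree along certain
directions (`powerKer_eq_prodSpan`), where dividing by `p_x` is easy. The same description gives
`P_+ = ker I_+`.

Next, `P_+ + J_+ = Π` (`prodForm_mul_mem_sup`). As `D_+` is the orthogonal space of `J_+`, it pairs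
injectively into the dual of `P_+`, so `dim D_+ ≤ dim P_+`.

Lower end: for generic `lam` distinct external bases have distinct vertices, so `#𝕀(X) ≤ #V`. A real
point set satisfies `#V ≤ dim Π(V)`, and `Π(V) ⊆ D_+` (`leastSpace_le_DPlus`): each `p_Y` with `Y`
long is the leading form of a product of affine forms that vanishes on `V`.

The chain `#𝕀(X) ≤ #V ≤ dim Π(V) ≤ dim D_+ ≤ dim P_+ = #𝕀(X)` collapses
(`externalVertices_generic`). Equality gives the duality of `D_+` and `P_+`, hence `P_+ ∩ J_+ = 0`;
correctness follows by a leading-term argument (`eq_zero_of_eval_eq_zero`). Both ideals vanish only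
at the origin, so no exponentials enter their kernels. -/

theorem seriesPderiv_comm {n : ℕ} (i j : Fin n) :
    Commute ((MvPowerSeries.pderiv ℂ i : Derivation ℂ (Series n) (Series n)) :
      Module.End ℂ (Series n)) ((MvPowerSeries.pderiv ℂ j : Derivation ℂ (Series n) (Series n)) :
      Module.End ℂ (Series n)) := by
  rcases eq_or_ne i j with rfl | hij
  · exact Commute.refl _
  refine LinearMap.ext fun f => MvPowerSeries.ext fun m => ?_
  simp only [Module.End.mul_apply, Derivation.coeFn_coe, MvPowerSeries.coeff_pderiv]
  rw [add_right_comm]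
  simp [hij, hij.symm]
  ring

/-- Endomorphisms form a noncommutative monoid, so multiplicativity of `monomialDiff` has to come
from pairwise commutation. -/
theorem list_prod_pow_add {M κ : Type*} [Monoid M] (l : List κ) (a : κ → M)
    (h : ∀ i j, Commute (a i) (a j)) (m m' : κ → ℕ) :
    (l.map fun i => a i ^ (m i + m' i)).prod =
      (l.map fun i => a i ^ m i).prod * (l.map fun i => a i ^ m' i).prod := by
  induction l with
  | nil => simp
  | cons i l ih =>
    have hc : Commute (a i ^ m' i) (l.map fun i => a i ^ m i).prod := by
      refine Commute.list_prod_right _ _ fun y hy => ?_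
      obtain ⟨j, -, rfl⟩ := List.mem_map.mp hy
      exact (h i j).pow_pow _ _
    simp only [List.map_cons, List.prod_cons, ih]
    rw [pow_add, mul_assoc, mul_assoc, ← mul_assoc (a i ^ m' i), hc.eq, mul_assoc]

theorem monomialDiff_add {n : ℕ} (m m' : Fin n →₀ ℕ) :
    monomialDiff (m + m') = monomialDiff m * monomialDiff m' :=
  list_prod_pow_add _ _ seriesPderiv_comm m m'

theorem diffOp_monomial {n : ℕ} (m : Fin n →₀ ℕ) (c : ℂ) :
    diffOp n (monomial m c) = c • monomialDiff m := by
  have h : (monomial m c : Poly n) = c • basisMonomials (Fin n) ℂ m := by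
    simp [smul_monomial]
  rw [h, map_smul, diffOp, Module.Basis.constr_basis]

theorem diffOp_mul {n : ℕ} (p q : Poly n) : diffOp n (p * q) = diffOp n p * diffOp n q := by
  induction p using MvPolynomial.induction_on' with
  | monomial m c =>
    induction q using MvPolynomial.induction_on' with
    | monomial m' c' =>
      rw [monomial_mul, diffOp_monomial, diffOp_monomial, diffOp_monomial, monomialDiff_add,
        smul_mul_smul_comm]
    | add q q' h h' => rw [mul_add, map_add, map_add, h, h', mul_add]
  | add p p' h h' => rw [add_mul, map_add, map_add, h, h', add_mul]

theorem diffOp_one {n : ℕ} : diffOp n 1 = 1 := by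
  have h := diffOp_monomial (0 : Fin n →₀ ℕ) 1
  rw [one_smul] at h
  refine h.trans ?_
  simp [monomialDiff]

theorem diffOp_C {n : ℕ} (c : ℂ) : diffOp n (C c) = c • 1 := by
  rw [← mul_one (C c), ← smul_eq_C_mul, map_smul, diffOp_one]

theorem diffOp_X {n : ℕ} (i : Fin n) : diffOp n (X i) =
    ((MvPowerSeries.pderiv ℂ i : Derivation ℂ (Series n) (Series n)) :
      Module.End ℂ (Series n)) := by
  rw [X, diffOp_monomial, one_smul, monomialDiff,
    List.prod_map_eq_pow_single i _ fun j hj _ => by simp [hj.symm]]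
  simp [List.count_finRange]

theorem pairing_mul {n : ℕ} (p q : Poly n) (f : Series n) :
    pairing (p * q) f = pairing p (diffOp n q f) := by
  simp [pairing, diffOp_mul]

/-- `m!`. -/
def multiFactorial {n : ℕ} (m : Fin n →₀ ℕ) : ℂ := ∏ i, ((m i).factorial : ℂ)

theorem multiFactorial_ne_zero {n : ℕ} (m : Fin n →₀ ℕ) : multiFactorial m ≠ 0 :=
  Finset.prod_ne_zero_iff.mpr fun _ _ => Nat.cast_ne_zero.mpr (Nat.factorial_ne_zero _)

theorem multiFactorial_add_single {n : ℕ} (m : Fin n →₀ ℕ) (i : Fin n) :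
    multiFactorial (m + Finsupp.single i 1) = (m i + 1) * multiFactorial m := by
  unfold multiFactorial
  rw [← Finset.mul_prod_erase _ _ (Finset.mem_univ i),
    ← Finset.mul_prod_erase (a := i) _ (fun i => ((m i).factorial : ℂ)) (Finset.mem_univ i)]
  rw [Finset.prod_congr (g := fun j => ((m j).factorial : ℂ)) rfl fun j hj => by
    simp [(Finset.ne_of_mem_erase hj).symm]]
  simp [Nat.factorial_succ]
  ring

theorem pairing_monomial {n : ℕ} (m : Fin n →₀ ℕ) (c : ℂ) (f : Series n) :
    pairing (monomial m c) f = c * (multiFactorial m * MvPowerSeries.coeff m f) := by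
  induction hd : m.degree generalizing m c f with
  | zero =>
    obtain rfl : m = 0 := (Finsupp.degree_eq_zero_iff m).mp hd
    simp [pairing, diffOp_C, multiFactorial, monomial_zero']
  | succ d ih =>
    obtain ⟨i, hi⟩ : ∃ i, m i ≠ 0 := by
      by_contra! h
      obtain rfl : m = 0 := Finsupp.ext h
      simp at hd
    obtain ⟨m', rfl⟩ : ∃ m', m = m' + Finsupp.single i 1 :=
      ⟨m - Finsupp.single i 1, (tsub_add_cancel_of_le (by
        rw [Finsupp.single_le_iff]; omega)).symm⟩
    have hd' : m'.degree = d := by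
      rw [map_add, Finsupp.degree_single] at hd
      omega
    have hX : (monomial (m' + Finsupp.single i 1) c : Poly n) = monomial m' c * X i := by
      rw [X, monomial_mul, mul_one]
    rw [hX, pairing_mul, ih _ _ _ hd', diffOp_X, Derivation.coeFn_coe,
      MvPowerSeries.coeff_pderiv, multiFactorial_add_single]
    ring

theorem pairing_add {n : ℕ} (p q : Poly n) (f : Series n) :
    pairing (p + q) f = pairing p f + pairing q f := by
  simp [pairing]

theorem pairing_smul {n : ℕ} (c : ℂ) (p : Poly n) (f : Series n) :
    pairing (c • p) f = c * pairing p f := by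
  simp [pairing]

/-- The pairing with a fixed series, as a functional on polynomials. -/
def pairingLeft {n : ℕ} (f : Series n) : Poly n →ₗ[ℂ] ℂ where
  toFun p := pairing p f
  map_add' p q := pairing_add p q f
  map_smul' c p := pairing_smul c p f

@[simp]
theorem pairingLeft_apply {n : ℕ} (f : Series n) (p : Poly n) :
    pairingLeft f p = pairing p f := rfl

theorem pairing_eq_sum {n : ℕ} (p : Poly n) (f : Series n) :
    pairing p f = ∑ m ∈ p.support, coeff m p * (multiFactorial m * MvPowerSeries.coeff m f) := by
  conv_lhs => rw [← pairingLeft_apply, p.as_sum, map_sum]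
  simp only [pairingLeft_apply, pairing_monomial]

theorem coeff_toSeries {n : ℕ} (p : Poly n) (m : Fin n →₀ ℕ) :
    MvPowerSeries.coeff m (toSeries n p) = coeff m p :=
  MvPolynomial.coeff_coe p m

theorem toSeries_injective (n : ℕ) : Function.Injective (toSeries n) :=
  MvPolynomial.coe_injective (Fin n) ℂ

theorem pairing_poly_comm {n : ℕ} (p q : Poly n) :
    pairing p (toSeries n q) = pairing q (toSeries n p) := by
  have h : pairingLeft (toSeries n q) = pairing q ∘ₗ toSeries n := by
    refine (basisMonomials (Fin n) ℂ).ext fun m => ?_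
    simp only [coe_basisMonomials, pairingLeft_apply, pairing_monomial, LinearMap.comp_apply,
      coeff_toSeries]
    rw [pairing_eq_sum]
    simp only [coeff_toSeries, coeff_monomial]
    simp +contextual [mul_comm]
  exact LinearMap.congr_fun h p

theorem eq_zero_of_forall_pairing {n : ℕ} {f : Series n} (h : ∀ p, pairing p f = 0) : f = 0 := by
  refine MvPowerSeries.ext fun m => ?_
  have := h (monomial m 1)
  rw [pairing_monomial, one_mul] at this
  simpa using (mul_eq_zero.mp this).resolve_left (multiFactorial_ne_zero m)

theorem pairing_expSeries {n : ℕ} (p : Poly n) (α : Fin n → ℂ) :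
    pairing p (expSeries α) = eval α p := by
  rw [pairing_eq_sum, eval_eq']
  refine Finset.sum_congr rfl fun m _ => ?_
  congr 1
  change _ * (∏ i, α i ^ m i / ((m i).factorial : ℂ)) = _
  rw [multiFactorial, ← Finset.prod_mul_distrib]
  refine Finset.prod_congr rfl fun i _ => ?_
  rw [mul_div_cancel₀]
  exact Nat.cast_ne_zero.mpr (Nat.factorial_ne_zero _)

theorem expSeries_zero {n : ℕ} : expSeries (0 : Fin n → ℂ) = 1 := by
  rw [← sub_eq_zero]
  refine eq_zero_of_forall_pairing fun p => ?_
  have h1 : (1 : Series n) = toSeries n 1 := (coe_one (σ := Fin n) (R := ℂ)).symm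
  rw [map_sub, pairing_expSeries, h1, pairing_poly_comm, pairing, diffOp_one]
  simp only [Module.End.one_apply, LinearMap.comp_apply, coeff_toSeries, eval_zero]
  exact sub_eq_zero.mpr rfl

/-- Complex conjugation of the coefficients. -/
def conjPoly {n : ℕ} : Poly n →+* Poly n := MvPolynomial.map (starRingEnd ℂ)

/-- The bilinear pairing has isotropic vectors over `ℂ`; conjugating one argument turns it into the
positive definite form `∑ m! |p_m|²`. -/
theorem eq_zero_of_pairing_conj_self {n : ℕ} {p : Poly n}
    (h : pairing (conjPoly p) (toSeries n p) = 0) : p = 0 := by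
  have hs : (conjPoly p).support = p.support :=
    support_map_of_injective _ (starRingEnd ℂ).injective
  have h2 : pairing (conjPoly p) (toSeries n p) =
      ((∑ m ∈ p.support, (∏ i, ((m i).factorial : ℝ)) * Complex.normSq (coeff m p) : ℝ) : ℂ) := by
    rw [pairing_eq_sum, hs]
    push_cast
    refine Finset.sum_congr rfl fun m _ => ?_
    rw [Complex.normSq_eq_conj_mul_self, coeff_toSeries, conjPoly, coeff_map, multiFactorial]
    ring
  rw [h2, Complex.ofReal_eq_zero, Finset.sum_eq_zero_iff_of_nonneg fun m _ =>
    mul_nonneg (Finset.prod_nonneg fun i _ => Nat.cast_nonneg _) (Complex.normSq_nonneg _)] at h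
  ext m
  by_contra hm
  have hm' : coeff m p ≠ 0 := by simpa using hm
  rcases mul_eq_zero.mp (h m (mem_support_iff.mpr hm')) with h0 | h0
  · rw [Finset.prod_eq_zero_iff] at h0
    obtain ⟨i, -, hi⟩ := h0
    exact Nat.factorial_ne_zero _ (Nat.cast_eq_zero.mp hi)
  · exact hm' (Complex.normSq_eq_zero.mp h0)

/-! ## Least terms -/

theorem coeff_leastTerm {n : ℕ} (f : Series n) (m : Fin n →₀ ℕ) :
    coeff m (leastTerm f) = if m.degree = f.order.toNat then MvPowerSeries.coeff m f else 0 := by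
  rw [leastTerm, coeff_sum]
  simp only [coeff_monomial, Finset.sum_ite_eq', Finset.mem_finsuppAntidiag]
  simp [Finsupp.degree_eq_sum]

theorem leastTerm_ne_zero {n : ℕ} {f : Series n} (hf : f ≠ 0) : leastTerm f ≠ 0 := by
  obtain ⟨m, hm, hd⟩ := MvPowerSeries.exists_coeff_ne_zero_and_order
    (MvPowerSeries.ne_zero_iff_order_finite.mp hf)
  intro h
  have h1 := coeff_leastTerm f m
  rw [h, if_pos (by rw [← hd]; rfl)] at h1
  exact hm (by simpa using h1.symm)

theorem leastTerm_isHomogeneous {n : ℕ} (f : Series n) :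
    (leastTerm f).IsHomogeneous f.order.toNat := by
  intro m hm
  rw [coeff_leastTerm] at hm
  rw [Pi.one_def, ← Finsupp.degree_eq_weight_one]
  by_contra h
  exact hm (if_neg h)

theorem coeff_eq_zero_of_degree_lt {n : ℕ} {f : Series n} {m : Fin n →₀ ℕ}
    (h : m.degree < f.order.toNat) : MvPowerSeries.coeff m f = 0 := by
  refine MvPowerSeries.coeff_of_lt_order (lt_of_lt_of_le (Nat.cast_lt.mpr h) ?_)
  exact ENat.natCast_toNat_le_self _

theorem pairing_congr {n : ℕ} {p : Poly n} {f g : Series n}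
    (h : ∀ m ∈ p.support, MvPowerSeries.coeff m f = MvPowerSeries.coeff m g) :
    pairing p f = pairing p g := by
  rw [pairing_eq_sum, pairing_eq_sum]
  exact Finset.sum_congr rfl fun m hm => by rw [h m hm]

/-- Up to its order, a series pairs like its least term. -/
theorem pairing_leastTerm {n : ℕ} {p : Poly n} {f : Series n}
    (h : p.totalDegree ≤ f.order.toNat) :
    pairing p (toSeries n (leastTerm f)) = pairing p f := by
  refine pairing_congr fun m hm => ?_
  rw [coeff_toSeries, coeff_leastTerm]
  split_ifs with hd
  · rfl
  · refine (coeff_eq_zero_of_degree_lt (lt_of_le_of_ne ?_ hd)).symm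
    refine le_trans ?_ h
    simpa [Finsupp.degree_eq_sum, Finsupp.sum_fintype] using le_totalDegree hm

theorem pairing_eq_zero_of_isHomogeneous {n : ℕ} {p q : Poly n} {d e : ℕ}
    (hp : p.IsHomogeneous d) (hq : q.IsHomogeneous e) (h : d ≠ e) :
    pairing p (toSeries n q) = 0 := by
  rw [pairing_eq_sum]
  refine Finset.sum_eq_zero fun m hm => ?_
  rw [coeff_toSeries, hq.coeff_eq_zero, mul_zero, mul_zero]
  have := hp (mem_support_iff.mp hm)
  rw [Pi.one_def, ← Finsupp.degree_eq_weight_one] at this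
  exact fun h' => h (this ▸ h')

theorem pairing_homogeneousComponent {n : ℕ} {p q : Poly n} {d : ℕ} (hq : q.IsHomogeneous d) :
    pairing (homogeneousComponent d p) (toSeries n q) = pairing p (toSeries n q) := by
  conv_rhs => rw [← sum_homogeneousComponent p, ← pairingLeft_apply, map_sum]
  simp only [pairingLeft_apply]
  by_cases hd : d ∈ Finset.range (p.totalDegree + 1)
  · rw [Finset.sum_eq_single_of_mem d hd fun e _ he => pairing_eq_zero_of_isHomogeneous
      (homogeneousComponent_isHomogeneous e p) hq he]
  · rw [homogeneousComponent_eq_zero _ _ (by simpa using hd), ← pairingLeft_apply, map_zero,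
      Finset.sum_eq_zero]
    refine fun e he => pairing_eq_zero_of_isHomogeneous
      (homogeneousComponent_isHomogeneous e p) hq ?_
    rintro rfl
    exact hd he

/-! ## Directional derivatives -/

/-- The derivative of polynomials in the direction `η`. -/
def dirDerivation {n : ℕ} (η : Fin n → ℝ) : Derivation ℂ (Poly n) (Poly n) :=
  mkDerivation ℂ fun i => C (η i : ℂ)

/-- The derivative of polynomials in the direction `η`, as an endomorphism. -/
def dirDeriv {n : ℕ} (η : Fin n → ℝ) : Module.End ℂ (Poly n) := dirDerivation η

theorem dirDeriv_mul {n : ℕ} (η : Fin n → ℝ) (p q : Poly n) :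
    dirDeriv η (p * q) = p * dirDeriv η q + q * dirDeriv η p :=
  (dirDerivation η).leibniz p q

theorem dirDeriv_X {n : ℕ} (η : Fin n → ℝ) (i : Fin n) : dirDeriv η (X i) = C (η i : ℂ) :=
  mkDerivation_X ℂ _ i

theorem dirDeriv_C {n : ℕ} (η : Fin n → ℝ) (c : ℂ) : dirDeriv η (C c) = 0 :=
  (dirDerivation η).map_algebraMap c

theorem dirDeriv_linForm {n : ℕ} (η x : Fin n → ℝ) :
    dirDeriv η (linForm x) = C ((x ⬝ᵥ η : ℝ) : ℂ) := by
  simp [linForm, dirDeriv_mul, dirDeriv_C, dirDeriv_X, dotProduct]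

theorem dirDeriv_add {n : ℕ} (η η' : Fin n → ℝ) :
    dirDeriv (η + η') = dirDeriv η + dirDeriv η' := by
  have h : dirDerivation (η + η') = dirDerivation η + dirDerivation η' :=
    MvPolynomial.derivation_ext fun i => by simp [dirDerivation]
  exact congrArg (fun D : Derivation ℂ (Poly n) (Poly n) => (D : Module.End ℂ (Poly n))) h

theorem dirDeriv_smul {n : ℕ} (c : ℝ) (η : Fin n → ℝ) :
    dirDeriv (c • η) = (c : ℂ) • dirDeriv η := by
  have h : dirDerivation (c • η) = (c : ℂ) • dirDerivation η :=
    MvPolynomial.derivation_ext fun i => by simp [dirDerivation, smul_eq_C_mul]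
  exact congrArg (fun D : Derivation ℂ (Poly n) (Poly n) => (D : Module.End ℂ (Poly n))) h

theorem dirDeriv_comm {n : ℕ} (η η' : Fin n → ℝ) : Commute (dirDeriv η) (dirDeriv η') := by
  have h : ⁅dirDerivation η, dirDerivation η'⁆ = 0 :=
    MvPolynomial.derivation_ext fun i => by simp [dirDerivation, Derivation.commutator_apply]
  refine LinearMap.ext fun f => sub_eq_zero.mp ?_
  have := congrArg (fun D : Derivation ℂ (Poly n) (Poly n) => D f) h
  rwa [Derivation.commutator_apply] at this

theorem diffOp_linForm_toSeries {n : ℕ} (η : Fin n → ℝ) (f : Poly n) :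
    diffOp n (linForm η) (toSeries n f) = toSeries n (dirDeriv η f) := by
  have hs : ∀ p : Poly n, (∑ i, (η i : ℂ) • pderiv i : Derivation ℂ (Poly n) (Poly n)) p =
      ∑ i, (η i : ℂ) • pderiv i p := fun p => by
    have := congrFun (map_sum (Derivation.coeFnAddMonoidHom (R := ℂ) (A := Poly n) (M := Poly n))
      (fun i => (η i : ℂ) • pderiv i) Finset.univ) p
    rwa [Finset.sum_apply] at this
  have h : dirDerivation η = ∑ i, (η i : ℂ) • pderiv i := by
    refine MvPolynomial.derivation_ext fun i => ?_
    rw [hs, dirDerivation, mkDerivation_X]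
    simp [pderiv_X, Pi.single_apply, smul_eq_C_mul]
  have h' : dirDeriv η f = ∑ i, (η i : ℂ) • pderiv i f := by
    rw [← hs, ← h]
    rfl
  rw [h', linForm]
  simp only [map_sum, LinearMap.sum_apply, map_smul]
  refine Finset.sum_congr rfl fun i _ => ?_
  rw [← smul_eq_C_mul, map_smul, diffOp_X, LinearMap.smul_apply, Derivation.coeFn_coe]
  congr 1
  exact MvPowerSeries.pderiv_coe f

theorem diffOp_linForm_pow_toSeries {n : ℕ} (η : Fin n → ℝ) (k : ℕ) (f : Poly n) :
    diffOp n (linForm η ^ k) (toSeries n f) = toSeries n ((dirDeriv η ^ k) f) := by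
  induction k generalizing f with
  | zero => simp [diffOp_one]
  | succ k ih => rw [pow_succ, diffOp_mul, Module.End.mul_apply, diffOp_linForm_toSeries, ih,
      pow_succ, Module.End.mul_apply]

/-- The higher Leibniz rule; only two terms survive because second derivatives of a linear form
vanish. -/
theorem dirDeriv_pow_succ_linForm_mul {n : ℕ} (η x : Fin n → ℝ) (k : ℕ) (q : Poly n) :
    (dirDeriv η ^ (k + 1)) (linForm x * q) = linForm x * (dirDeriv η ^ (k + 1)) q +
      C ((k + 1) * ((x ⬝ᵥ η : ℝ) : ℂ)) * (dirDeriv η ^ k) q := by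
  induction k with
  | zero => simp [dirDeriv_mul, dirDeriv_linForm, mul_comm q]
  | succ k ih =>
    rw [pow_succ' (dirDeriv η) (k + 1), Module.End.mul_apply, Module.End.mul_apply, ih, map_add,
      dirDeriv_mul, dirDeriv_linForm,
      dirDeriv_mul, dirDeriv_C,
      pow_succ' _ k]
    simp only [Module.End.mul_apply, mul_zero, add_zero, Nat.cast_add, Nat.cast_one, map_mul,
      map_add, map_one]
    ring

theorem dirDeriv_pow_linForm_mul_of_eq_zero {n : ℕ} {η x : Fin n → ℝ} (h : x ⬝ᵥ η = 0) (k : ℕ)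
    (q : Poly n) : (dirDeriv η ^ k) (linForm x * q) = linForm x * (dirDeriv η ^ k) q := by
  cases k with
  | zero => simp
  | succ k => rw [dirDeriv_pow_succ_linForm_mul, h]; simp

theorem linForm_single {n : ℕ} (i : Fin n) :
    linForm (Pi.single i 1) = (X i : Poly n) := by
  rw [linForm, Finset.sum_eq_single i]
  · simp
  · intro j _ hj
    simp [hj]
  · simp

theorem exists_dirDeriv_pow_eq_zero {n : ℕ} (η : Fin n → ℝ) (q : Poly n) :
    ∃ N, (dirDeriv η ^ N) q = 0 := by
  have hle : ∀ {N M : ℕ} {p : Poly n}, (dirDeriv η ^ N) p = 0 → N ≤ M →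
      (dirDeriv η ^ M) p = 0 := by
    intro N M p h hNM
    obtain ⟨k, rfl⟩ := Nat.exists_eq_add_of_le' hNM
    rw [pow_add, Module.End.mul_apply, h, map_zero]
  induction q using MvPolynomial.induction_on with
  | C c => exact ⟨1, by rw [pow_one, dirDeriv_C]⟩
  | add p q hp hq =>
    obtain ⟨N, hN⟩ := hp
    obtain ⟨M, hM⟩ := hq
    exact ⟨max N M, by rw [map_add, hle hN (le_max_left _ _), hle hM (le_max_right _ _), add_zero]⟩
  | mul_X p i hp =>
    obtain ⟨N, hN⟩ := hp
    refine ⟨N + 1, ?_⟩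
    rw [← linForm_single, mul_comm, dirDeriv_pow_succ_linForm_mul, hle hN (Nat.le_succ N), hN]
    simp

/-- A factor not orthogonal to `η` raises the degree along `η` by exactly one. If `N > k` is the
least exponent annihilating `q`, the `N`-th derivative of the product is `N (x ⋅ η)` times the
nonzero `(N - 1)`-st derivative of `q`, yet it must vanish. -/
theorem dirDeriv_pow_eq_zero_of_linForm_mul {n : ℕ} {η x : Fin n → ℝ} (h : x ⬝ᵥ η ≠ 0) {k : ℕ}
    {q : Poly n} (hq : (dirDeriv η ^ (k + 1)) (linForm x * q) = 0) :
    (dirDeriv η ^ k) q = 0 := by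
  classical
  have hex := exists_dirDeriv_pow_eq_zero η q
  have hN := Nat.find_spec hex
  have hmin := fun m => Nat.find_min (H := hex) (m := m)
  generalize Nat.find hex = N at hN hmin
  rcases le_or_gt N k with hle | hlt
  · obtain ⟨j, rfl⟩ := Nat.exists_eq_add_of_le' hle
    rw [pow_add, Module.End.mul_apply, hN, map_zero]
  · obtain ⟨j, rfl⟩ := Nat.exists_eq_add_of_lt hlt
    exfalso
    refine hmin (k + j) (by omega) ?_
    have h1 : (dirDeriv η ^ (k + j + 1)) (linForm x * q) = 0 := by
      rw [show k + j + 1 = j + (k + 1) by ring, pow_add, Module.End.mul_apply, hq, map_zero]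
    rw [dirDeriv_pow_succ_linForm_mul, hN, mul_zero, zero_add] at h1
    refine (mul_eq_zero.mp h1).resolve_left ?_
    rw [C_eq_zero, mul_eq_zero, not_or]
    exact ⟨by exact_mod_cast Nat.succ_ne_zero (k + j), Complex.ofReal_ne_zero.mpr h⟩

theorem eq_C_of_forall_dirDeriv {n : ℕ} {f : Poly n} (h : ∀ η, dirDeriv η f = 0) :
    f = C (coeff 0 f) := by
  have hp : ∀ i, pderiv i f = 0 := by
    intro i
    have h1 : dirDerivation (Pi.single i (1 : ℝ)) = pderiv i := by
      refine MvPolynomial.derivation_ext fun j => ?_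
      rcases eq_or_ne i j with rfl | hij
      · simp [dirDerivation]
      · simp [dirDerivation, pderiv_X, hij.symm]
    rw [← h1]
    exact h _
  ext m
  rw [coeff_C]
  split_ifs with hm
  · rw [hm]
  obtain ⟨i, hi⟩ : ∃ i, m i ≠ 0 := by
    by_contra! h'
    exact hm (Finsupp.ext fun i => (h' i).symm)
  have h1 := congrArg (coeff (m - Finsupp.single i 1)) (hp i)
  rw [coeff_pderiv, tsub_add_cancel_of_le (by rw [Finsupp.single_le_iff]; omega), coeff_zero] at h1
  exact (mul_eq_zero.mp h1).resolve_right (Nat.cast_add_one_ne_zero _)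

theorem linForm_ne_zero {n : ℕ} {x : Fin n → ℝ} (hx : x ≠ 0) : linForm x ≠ 0 := by
  intro h
  have h1 := dirDeriv_linForm x x
  rw [h, map_zero, eq_comm, C_eq_zero, Complex.ofReal_eq_zero] at h1
  exact hx (dotProduct_self_eq_zero.mp h1)

theorem linForm_add {n : ℕ} (x y : Fin n → ℝ) : linForm (x + y) = linForm x + linForm y := by
  simp [linForm, add_mul, Finset.sum_add_distrib]

theorem linForm_smul {n : ℕ} (c : ℝ) (x : Fin n → ℝ) :
    linForm (c • x) = C (c : ℂ) * linForm x := by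
  simp [linForm, Finset.mul_sum, mul_assoc]

theorem linForm_zero {n : ℕ} : linForm (0 : Fin n → ℝ) = 0 := by
  simp [linForm]

/-! ## Contraction -/

/-- The substitution `t ↦ t - (x ⋅ t) w`. -/
def shear {n : ℕ} (x w : Fin n → ℝ) : Poly n →ₐ[ℂ] Poly n :=
  aeval fun i => X i - C (w i : ℂ) * linForm x

/-- The family obtained from `X` by the projection along `x` orthogonal to `w`. -/
def contract {n : ℕ} {ι : Type*} (X : ι → Fin n → ℝ) (x w : Fin n → ℝ) : ι → Fin n → ℝ :=
  fun y => X y - (X y ⬝ᵥ w) • x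

theorem shear_linForm {n : ℕ} (x w y : Fin n → ℝ) :
    shear x w (linForm y) = linForm (y - (y ⬝ᵥ w) • x) := by
  have h1 : shear x w (linForm y) = linForm y - C ((y ⬝ᵥ w : ℝ) : ℂ) * linForm x := by
    simp only [shear, linForm, map_sum, map_mul, aeval_X, aeval_C, dotProduct, algebraMap_eq,
      Complex.ofReal_sum, Complex.ofReal_mul, mul_sub, Finset.sum_sub_distrib, Finset.sum_mul,
      mul_assoc]
  rw [h1, sub_eq_add_neg y, linForm_add, ← neg_smul, linForm_smul]
  push_cast
  rw [map_neg]
  ring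

theorem shear_prodForm {n : ℕ} {ι : Type*} (X : ι → Fin n → ℝ) (x w : Fin n → ℝ) (Y : Finset ι) :
    shear x w (prodForm X Y) = prodForm (contract X x w) Y := by
  simp only [prodForm, map_prod, shear_linForm, contract]

/-- Modulo `linForm x` the substitution fixes every variable, hence every polynomial. -/
theorem linForm_dvd_sub_shear {n : ℕ} (x w : Fin n → ℝ) (f : Poly n) :
    linForm x ∣ f - shear x w f := by
  rw [← Ideal.mem_span_singleton, ← Ideal.Quotient.eq]
  have h : (Ideal.Quotient.mkₐ ℂ (Ideal.span {linForm x})) =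
      (Ideal.Quotient.mkₐ ℂ (Ideal.span {linForm x})).comp (shear x w) := by
    refine MvPolynomial.algHom_ext fun i => ?_
    simp only [AlgHom.comp_apply, shear, aeval_X, Ideal.Quotient.mkₐ_eq_mk]
    rw [Ideal.Quotient.eq, Ideal.mem_span_singleton, sub_sub_cancel]
    exact Dvd.intro_left _ rfl
  exact AlgHom.congr_fun h f

/-- The chain rule: `η - (x ⬝ᵥ η) • w` is the image of `η` under the linear map that is substituted.
-/
theorem dirDeriv_shear {n : ℕ} (x w η : Fin n → ℝ) (f : Poly n) :
    dirDeriv η (shear x w f) = shear x w (dirDeriv (η - (x ⬝ᵥ η) • w) f) := by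
  induction f using MvPolynomial.induction_on with
  | C c => simp [dirDeriv_C, shear]
  | add p q hp hq => simp only [map_add, hp, hq]
  | mul_X p i hp =>
    rw [map_mul, dirDeriv_mul, hp, dirDeriv_mul, map_add, map_mul, map_mul]
    congr 2
    simp [shear, dirDeriv_X, dirDeriv_mul, dirDeriv_C, dirDeriv_linForm, mul_comm]

theorem dirDeriv_pow_shear {n : ℕ} (x w η : Fin n → ℝ) (k : ℕ) (f : Poly n) :
    (dirDeriv η ^ k) (shear x w f) = shear x w ((dirDeriv (η - (x ⬝ᵥ η) • w) ^ k) f) := by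
  induction k generalizing f with
  | zero => simp
  | succ k ih => rw [pow_succ, pow_succ, Module.End.mul_apply, Module.End.mul_apply,
      dirDeriv_shear, ih]

/-! ## Spans of products of linear forms as kernels of power ideals -/

/-- The span of the products `p_Y`, `Y ⊆ S`. -/
def prodSpan {n : ℕ} {ι : Type*} (X : ι → Fin n → ℝ) (S : Finset ι) : Submodule ℂ (Poly n) :=
  Submodule.span ℂ (prodForm X '' {Y | Y ⊆ S})

/-- `η` is orthogonal to all of `X|S`, or a normal of a hyperplane of the span of `X|S`
that is spanned by members of `X|S`. -/
def IsFlatNormal {n : ℕ} {ι : Type*} (X : ι → Fin n → ℝ) (S : Finset ι) (η : Fin n → ℝ) : Prop :=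
  ∀ z ∈ Submodule.span ℝ (X '' S), z ⬝ᵥ η = 0 →
    z ∈ Submodule.span ℝ (X '' {y | y ∈ S ∧ X y ⬝ᵥ η = 0})

open Classical in
/-- The number of members of `X|S` that are not orthogonal to `η`. -/
def nonOrthCount {n : ℕ} {ι : Type*} (X : ι → Fin n → ℝ) (S : Finset ι) (η : Fin n → ℝ) : ℕ :=
  (S.filter fun y => X y ⬝ᵥ η ≠ 0).card

/-- The polynomials of degree at most `nonOrthCount X S η` along every flat normal `η`. -/
def powerKer {n : ℕ} {ι : Type*} (X : ι → Fin n → ℝ) (S : Finset ι) : Submodule ℂ (Poly n) :=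
  ⨅ η ∈ {η | IsFlatNormal X S η}, LinearMap.ker (dirDeriv η ^ (nonOrthCount X S η + 1))

theorem mem_powerKer {n : ℕ} {ι : Type*} {X : ι → Fin n → ℝ} {S : Finset ι} {f : Poly n} :
    f ∈ powerKer X S ↔ ∀ η, IsFlatNormal X S η → (dirDeriv η ^ (nonOrthCount X S η + 1)) f = 0 := by
  simp [powerKer, Submodule.mem_iInf]

variable {n : ℕ} {ι : Type*}

theorem prodForm_mem_prodSpan (X : ι → Fin n → ℝ) {S Y : Finset ι} (h : Y ⊆ S) :
    prodForm X Y ∈ prodSpan X S :=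
  Submodule.subset_span ⟨Y, h, rfl⟩

theorem prodSpan_mono (X : ι → Fin n → ℝ) {S T : Finset ι} (h : S ⊆ T) :
    prodSpan X S ≤ prodSpan X T :=
  Submodule.span_mono (Set.image_mono fun _ hY => Finset.Subset.trans hY h)

theorem linForm_mul_mem_prodSpan [DecidableEq ι] (X : ι → Fin n → ℝ) {S : Finset ι} {i : ι}
    (hi : i ∉ S) {q : Poly n} (hq : q ∈ prodSpan X S) :
    linForm (X i) * q ∈ prodSpan X (insert i S) := by
  induction hq using Submodule.span_induction with
  | mem q hq =>
    obtain ⟨Y, hY, rfl⟩ := hq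
    rw [prodForm, ← Finset.prod_insert (f := fun y => linForm (X y)) fun h => hi (hY h)]
    exact prodForm_mem_prodSpan X (Finset.insert_subset_insert i hY)
  | zero => simp
  | add p q _ _ hp hq => rw [mul_add]; exact add_mem hp hq
  | smul c p _ hp => rw [mul_smul_comm]; exact Submodule.smul_mem _ c hp

theorem map_shear_prodSpan (X : ι → Fin n → ℝ) (x w : Fin n → ℝ) (S : Finset ι) :
    (prodSpan X S).map (shear x w).toLinearMap = prodSpan (contract X x w) S := by
  rw [prodSpan, prodSpan, Submodule.map_span, Set.image_image]
  simp only [AlgHom.toLinearMap_apply, shear_prodForm]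

theorem nonOrthCount_insert [DecidableEq ι] (X : ι → Fin n → ℝ) {S : Finset ι} {i : ι}
    (hi : i ∉ S) (η : Fin n → ℝ) : nonOrthCount X (insert i S) η =
      nonOrthCount X S η + if X i ⬝ᵥ η = 0 then 0 else 1 := by
  classical
  unfold nonOrthCount
  rw [Finset.filter_insert]
  by_cases h : X i ⬝ᵥ η = 0
  · simp [h]
  · simp [h, hi]

theorem nonOrthCount_congr {X X' : ι → Fin n → ℝ} {S : Finset ι} {η η' : Fin n → ℝ}
    (h : ∀ y ∈ S, X y ⬝ᵥ η = X' y ⬝ᵥ η') : nonOrthCount X S η = nonOrthCount X' S η' := by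
  unfold nonOrthCount
  congr 1
  exact Finset.filter_congr fun y hy => by rw [h y hy]

theorem dirDeriv_pow_prodForm (X : ι → Fin n → ℝ) (η : Fin n → ℝ) (Y : Finset ι) :
    (dirDeriv η ^ (nonOrthCount X Y η + 1)) (prodForm X Y) = 0 := by
  classical
  induction Y using Finset.induction_on with
  | empty =>
    have h1 : prodForm X ∅ = C (σ := Fin n) (1 : ℂ) := by simp [prodForm]
    rw [h1, pow_succ, Module.End.mul_apply, dirDeriv_C, map_zero]
  | insert i Y hi ih =>
    rw [prodForm, Finset.prod_insert hi, nonOrthCount_insert X hi]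
    change (dirDeriv η ^ _) (linForm (X i) * prodForm X Y) = 0
    split_ifs with h
    · rw [dirDeriv_pow_linForm_mul_of_eq_zero h, add_zero, ih, mul_zero]
    · rw [dirDeriv_pow_succ_linForm_mul, ih, mul_zero, add_zero, pow_succ', Module.End.mul_apply,
        ih, map_zero, mul_zero]

theorem dirDeriv_pow_eq_zero_of_le {η : Fin n → ℝ} {a b : ℕ} (hab : a ≤ b) {f : Poly n}
    (h : (dirDeriv η ^ a) f = 0) : (dirDeriv η ^ b) f = 0 := by
  obtain ⟨k, rfl⟩ := Nat.exists_eq_add_of_le' hab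
  rw [pow_add, Module.End.mul_apply, h, map_zero]

theorem dirDeriv_pow_prodSpan {X : ι → Fin n → ℝ} (η : Fin n → ℝ) {S : Finset ι} {f : Poly n}
    (hf : f ∈ prodSpan X S) : (dirDeriv η ^ (nonOrthCount X S η + 1)) f = 0 := by
  induction hf using Submodule.span_induction with
  | mem f hf =>
    obtain ⟨Y, hY, rfl⟩ := hf
    refine dirDeriv_pow_eq_zero_of_le ?_ (dirDeriv_pow_prodForm X η Y)
    exact Nat.succ_le_succ (Finset.card_le_card (Finset.filter_subset_filter _ hY))
  | zero => simp
  | add p q _ _ hp hq => rw [map_add, hp, hq, add_zero]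
  | smul c p _ hp => rw [map_smul, hp, smul_zero]

theorem prodSpan_le_powerKer (X : ι → Fin n → ℝ) (S : Finset ι) :
    prodSpan X S ≤ powerKer X S :=
  fun _ hf => mem_powerKer.mpr fun η _ => dirDeriv_pow_prodSpan η hf

theorem exists_dotProduct_eq (f : (Fin n → ℝ) →ₗ[ℝ] ℝ) :
    ∃ η : Fin n → ℝ, ∀ z, z ⬝ᵥ η = f z := by
  refine ⟨fun i => f (Pi.single i 1), fun z => ?_⟩
  conv_rhs => rw [← (Pi.basisFun ℝ (Fin n)).sum_repr z, map_sum]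
  simp [dotProduct]

theorem exists_dotProduct_ne_zero_of_notMem {W : Submodule ℝ (Fin n → ℝ)} {x : Fin n → ℝ}
    (hx : x ∉ W) : ∃ η : Fin n → ℝ, x ⬝ᵥ η ≠ 0 ∧ ∀ z ∈ W, z ⬝ᵥ η = 0 := by
  obtain ⟨f, hf, hW⟩ := Submodule.exists_le_ker_of_notMem hx
  obtain ⟨η, hη⟩ := exists_dotProduct_eq f
  exact ⟨η, by rwa [hη], fun z hz => by rw [hη]; exact hW hz⟩

theorem image_insert_coe [DecidableEq ι] (X : ι → Fin n → ℝ) (S : Finset ι) (i : ι) :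
    X '' ((insert i S : Finset ι) : Set ι) = insert (X i) (X '' S) := by
  rw [Finset.coe_insert, Set.image_insert_eq]

theorem span_orth_le_insert [DecidableEq ι] (X : ι → Fin n → ℝ) (S : Finset ι) (i : ι)
    (η : Fin n → ℝ) : Submodule.span ℝ (X '' {y | y ∈ S ∧ X y ⬝ᵥ η = 0}) ≤
      Submodule.span ℝ (X '' {y | y ∈ insert i S ∧ X y ⬝ᵥ η = 0}) :=
  Submodule.span_mono (Set.image_mono fun _ hy => ⟨Finset.mem_insert_of_mem hy.1, hy.2⟩)

theorem IsFlatNormal.insert_of_mem_span [DecidableEq ι] {X : ι → Fin n → ℝ} {S : Finset ι} {i : ι}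
    (hi : X i ∈ Submodule.span ℝ (X '' S)) {η : Fin n → ℝ} (h : IsFlatNormal X S η) :
    IsFlatNormal X (insert i S) η := by
  intro z hz hzη
  rw [image_insert_coe, Submodule.span_insert_eq_span hi] at hz
  exact span_orth_le_insert X S i η (h z hz hzη)

theorem dotProduct_eq_zero_of_mem_span {s : Set (Fin n → ℝ)} {η : Fin n → ℝ}
    (h : ∀ y ∈ s, y ⬝ᵥ η = 0) {z : Fin n → ℝ} (hz : z ∈ Submodule.span ℝ s) : z ⬝ᵥ η = 0 := by
  induction hz using Submodule.span_induction with
  | mem z hz => exact h z hz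
  | zero => simp
  | add a b _ _ ha hb => rw [add_dotProduct, ha, hb, add_zero]
  | smul c a _ ha => rw [smul_dotProduct, ha, smul_zero]

theorem dirDeriv_pow_sub_smul {η η₀ : Fin n → ℝ} (c : ℝ) {q : Poly n} (hq : dirDeriv η₀ q = 0)
    (k : ℕ) : (dirDeriv (η - c • η₀) ^ k) q = (dirDeriv η ^ k) q := by
  induction k with
  | zero => simp
  | succ k ih =>
    have h0 : dirDeriv η₀ ((dirDeriv η ^ k) q) = 0 := by
      rw [← Module.End.mul_apply, ((dirDeriv_comm η₀ η).pow_right k).eq, Module.End.mul_apply, hq,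
        map_zero]
    rw [pow_succ', Module.End.mul_apply, ih, sub_eq_add_neg, ← neg_smul, dirDeriv_add,
      dirDeriv_smul, LinearMap.add_apply, LinearMap.smul_apply, h0, smul_zero, add_zero, pow_succ',
      Module.End.mul_apply]

/-- Division by `p_x` inside the kernel description, which is what makes the deletion-contraction
sequence exact. If `X i` lies in the span of `X|S`, flat normals of `S` stay flat and the factor
accounts for the change in the count. Otherwise a flat normal `η` of `S` is first tilted to become
orthogonal to `X i`. -/
theorem linForm_mul_mem_powerKer [DecidableEq ι] {X : ι → Fin n → ℝ} {S : Finset ι} {i : ι}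
    (hi : i ∉ S) (hXi : X i ≠ 0) {q : Poly n}
    (hq : linForm (X i) * q ∈ powerKer X (insert i S)) : q ∈ powerKer X S := by
  rw [mem_powerKer] at hq ⊢
  intro η hη
  by_cases hspan : X i ∈ Submodule.span ℝ (X '' S)
  · have h := hq η (hη.insert_of_mem_span hspan)
    rw [nonOrthCount_insert X hi] at h
    split_ifs at h with h0
    · rw [dirDeriv_pow_linForm_mul_of_eq_zero h0] at h
      exact (mul_eq_zero.mp h).resolve_left (linForm_ne_zero hXi)
    · exact dirDeriv_pow_eq_zero_of_linForm_mul h0 h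
  · obtain ⟨η₀, hi₀, hS₀⟩ := exists_dotProduct_ne_zero_of_notMem hspan
    have hmem : ∀ y ∈ S, X y ⬝ᵥ η₀ = 0 := fun y hy =>
      hS₀ _ (Submodule.subset_span ⟨y, hy, rfl⟩)
    -- Only `X i` is not orthogonal to `η₀`, so the count is `1`, the exponent is `2`, and
    -- cancelling the factor leaves a first derivative.
    have hq₀ : dirDeriv η₀ q = 0 := by
      have hflat : IsFlatNormal X (insert i S) η₀ := by
        intro z hz hz0
        rw [image_insert_coe, Submodule.mem_span_insert] at hz
        obtain ⟨a, s, hs, rfl⟩ := hz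
        rw [add_dotProduct, hS₀ s hs, add_zero, smul_dotProduct, smul_eq_mul] at hz0
        rw [(mul_eq_zero.mp hz0).resolve_right hi₀, zero_smul, zero_add]
        refine Submodule.span_mono (Set.image_mono fun y hy => ?_) hs
        exact ⟨Finset.mem_insert_of_mem hy, hmem y hy⟩
      have hcount : nonOrthCount X S η₀ = 0 := by
        rw [nonOrthCount, Finset.card_eq_zero, Finset.filter_eq_empty_iff]
        exact fun y hy => not_not.mpr (hmem y hy)
      have h := hq η₀ hflat
      rw [nonOrthCount_insert X hi, hcount, if_neg hi₀] at h
      simpa using dirDeriv_pow_eq_zero_of_linForm_mul hi₀ h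
    -- This `c` makes `η - c • η₀` orthogonal to `X i`. The products with members of `X|S` are
    -- unchanged, and so are the derivatives of `q`, which is constant along `η₀`.
    set c := (X i ⬝ᵥ η) / (X i ⬝ᵥ η₀)
    have hi' : X i ⬝ᵥ (η - c • η₀) = 0 := by
      rw [dotProduct_sub, dotProduct_smul, smul_eq_mul, div_mul_cancel₀ _ hi₀, sub_self]
    have hS' : ∀ z ∈ Submodule.span ℝ (X '' S), z ⬝ᵥ (η - c • η₀) = z ⬝ᵥ η := fun z hz => by
      rw [dotProduct_sub, dotProduct_smul, hS₀ z hz, smul_zero, sub_zero]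
    have hmem' : ∀ y ∈ S, X y ⬝ᵥ (η - c • η₀) = X y ⬝ᵥ η := fun y hy =>
      hS' _ (Submodule.subset_span ⟨y, hy, rfl⟩)
    have hflat : IsFlatNormal X (insert i S) (η - c • η₀) := by
      intro z hz hz0
      rw [image_insert_coe, Submodule.mem_span_insert] at hz
      obtain ⟨a, s, hs, rfl⟩ := hz
      rw [add_dotProduct, smul_dotProduct, hi', smul_zero, zero_add, hS' s hs] at hz0
      refine add_mem (Submodule.smul_mem _ _ (Submodule.subset_span
        ⟨i, ⟨Finset.mem_insert_self i S, hi'⟩, rfl⟩)) ?_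
      refine Submodule.span_mono (Set.image_mono fun y hy => ?_) (hη s hs hz0)
      exact ⟨Finset.mem_insert_of_mem hy.1, (hmem' y hy.1).trans hy.2⟩
    have h := hq _ hflat
    rw [nonOrthCount_insert X hi, if_pos hi', add_zero,
      dirDeriv_pow_linForm_mul_of_eq_zero hi', nonOrthCount_congr hmem',
      dirDeriv_pow_sub_smul c hq₀] at h
    exact (mul_eq_zero.mp h).resolve_left (linForm_ne_zero hXi)

theorem contract_dotProduct (X : ι → Fin n → ℝ) (x w η : Fin n → ℝ) (y : ι) :
    contract X x w y ⬝ᵥ η = X y ⬝ᵥ (η - (x ⬝ᵥ η) • w) := by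
  simp only [contract, sub_dotProduct, dotProduct_sub, smul_dotProduct, dotProduct_smul,
    smul_eq_mul]
  ring

/-- Differentiating the sheared polynomial along `η` amounts to differentiating `f` along `η' = η -
(X i ⬝ᵥ η) • w`. This `η'` is orthogonal to `X i` and meets the members of `X|S` as `η` meets the
contracted ones, so the counts agree. -/
theorem shear_mem_powerKer [DecidableEq ι] {X : ι → Fin n → ℝ} {S : Finset ι} {i : ι}
    (hi : i ∉ S) {w : Fin n → ℝ} (hw : X i ⬝ᵥ w = 1) {f : Poly n}
    (hf : f ∈ powerKer X (insert i S)) :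
    shear (X i) w f ∈ powerKer (contract X (X i) w) S := by
  rw [mem_powerKer] at hf ⊢
  intro η hη
  have hi' : X i ⬝ᵥ (η - (X i ⬝ᵥ η) • w) = 0 := by
    rw [dotProduct_sub, dotProduct_smul, hw, smul_eq_mul, mul_one, sub_self]
  have hdot := contract_dotProduct X (X i) w η
  have hflat : IsFlatNormal X (insert i S) (η - (X i ⬝ᵥ η) • w) := by
    intro z hz hz0
    have hXi : X i ∈ Submodule.span ℝ
        (X '' {y | y ∈ insert i S ∧ X y ⬝ᵥ (η - (X i ⬝ᵥ η) • w) = 0}) :=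
      Submodule.subset_span ⟨i, ⟨Finset.mem_insert_self i S, hi'⟩, rfl⟩
    -- Modulo `X i`, the span of the enlarged family is the contracted span. On the latter `η` and
    -- `η'` agree, since contracted vectors are orthogonal to `w`.
    have hz' : ∃ a : ℝ, z - a • X i ∈ Submodule.span ℝ (contract X (X i) w '' S) := by
      clear hz0
      induction hz using Submodule.span_induction with
      | mem z hz =>
        obtain ⟨y, hy, rfl⟩ := hz
        rcases Finset.mem_insert.mp (Finset.mem_coe.mp hy) with rfl | hy
        · exact ⟨1, by simp⟩
        · exact ⟨X y ⬝ᵥ w, Submodule.subset_span ⟨y, hy, rfl⟩⟩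
      | zero => exact ⟨0, by simp⟩
      | add u v _ _ hu hv =>
        obtain ⟨a, ha⟩ := hu
        obtain ⟨b, hb⟩ := hv
        refine ⟨a + b, ?_⟩
        convert add_mem ha hb using 1
        module
      | smul c u _ hu =>
        obtain ⟨a, ha⟩ := hu
        refine ⟨c * a, ?_⟩
        convert Submodule.smul_mem _ c ha using 1
        module
    obtain ⟨a, ha⟩ := hz'
    have hw0 : ∀ y ∈ contract X (X i) w '' S, y ⬝ᵥ w = 0 := by
      rintro _ ⟨y, -, rfl⟩
      rw [contract_dotProduct, hw, one_smul, sub_self, dotProduct_zero]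
    have h0 : (z - a • X i) ⬝ᵥ η = 0 := by
      have h1 : (z - a • X i) ⬝ᵥ (η - (X i ⬝ᵥ η) • w) = 0 := by
        rw [sub_dotProduct, hz0, smul_dotProduct, hi', smul_zero, sub_zero]
      rwa [dotProduct_sub, dotProduct_smul, dotProduct_eq_zero_of_mem_span hw0 ha, smul_zero,
        sub_zero] at h1
    have h2 : z - a • X i ∈ Submodule.span ℝ
        (X '' {y | y ∈ insert i S ∧ X y ⬝ᵥ (η - (X i ⬝ᵥ η) • w) = 0}) := by
      refine Submodule.span_le.mpr ?_ (hη _ ha h0)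
      rintro _ ⟨y, ⟨hy, hy0⟩, rfl⟩
      refine sub_mem (Submodule.subset_span ⟨y, ⟨Finset.mem_insert_of_mem hy, ?_⟩, rfl⟩)
        (Submodule.smul_mem _ _ hXi)
      rw [← hdot, hy0]
    simpa using add_mem h2 (Submodule.smul_mem _ a hXi)
  have h := hf _ hflat
  rw [nonOrthCount_insert X hi, if_pos hi', add_zero] at h
  rw [dirDeriv_pow_shear, nonOrthCount_congr fun y _ => hdot y, h, map_zero]

theorem exists_dotProduct_eq_one {x : Fin n → ℝ} (hx : x ≠ 0) : ∃ w, x ⬝ᵥ w = 1 :=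
  ⟨(x ⬝ᵥ x)⁻¹ • x, by
    rw [dotProduct_smul, smul_eq_mul, inv_mul_cancel₀ (mt dotProduct_self_eq_zero.mp hx)]⟩

/-- Induction by contraction and deletion: the sheared `f` is handled by the contracted family and
lifts to some `g` in the span; then `f - g` is divisible by `p_x`, and the quotient is handled by
`S`. The family `X` must vary in the induction because of the contraction. -/
theorem powerKer_le_prodSpan (X : ι → Fin n → ℝ) (S : Finset ι) : powerKer X S ≤ prodSpan X S := by
  classical
  induction S using Finset.induction_on generalizing X with
  | empty =>
    intro f hf
    -- Over the empty set every direction is a flat normal with count `0`, so all first derivatives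
    -- vanish.
    have h1 : f = C (coeff 0 f) := by
      refine eq_C_of_forall_dirDeriv fun η => ?_
      have h := mem_powerKer.mp hf η fun z hz _ => by
        simp only [Finset.coe_empty, Set.image_empty, Submodule.span_empty,
          Submodule.mem_bot] at hz
        rw [hz]
        exact zero_mem _
      simpa [nonOrthCount] using h
    rw [h1, ← mul_one (C _), ← smul_eq_C_mul]
    exact Submodule.smul_mem _ _ (Submodule.subset_span ⟨∅, Finset.Subset.refl _, by simp [prodForm]⟩)
  | insert i S hi ih =>
    intro f hf
    rcases eq_or_ne (X i) 0 with h0 | h0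
    -- A zero vector changes neither the flat normals nor the counts.
    · refine prodSpan_mono X (Finset.subset_insert i S) (ih X (mem_powerKer.mpr fun η hη => ?_))
      have h := mem_powerKer.mp hf η (hη.insert_of_mem_span (by rw [h0]; exact zero_mem _))
      rwa [nonOrthCount_insert X hi, h0, zero_dotProduct, if_pos rfl, add_zero] at h
    · obtain ⟨w, hw⟩ := exists_dotProduct_eq_one h0
      have h1 := ih _ (shear_mem_powerKer hi hw hf)
      rw [← map_shear_prodSpan] at h1
      obtain ⟨g, hg, hgf⟩ := h1
      obtain ⟨q, hq⟩ : linForm (X i) ∣ f - g := by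
        have := dvd_sub (linForm_dvd_sub_shear (X i) w f) (linForm_dvd_sub_shear (X i) w g)
        rw [AlgHom.toLinearMap_apply] at hgf
        rwa [hgf, sub_sub_sub_cancel_right] at this
      have hg' := prodSpan_mono X (Finset.subset_insert i S) hg
      have hq' : q ∈ prodSpan X S := by
        refine ih X (linForm_mul_mem_powerKer hi h0 ?_)
        rw [← hq]
        exact sub_mem hf (prodSpan_le_powerKer X _ hg')
      rw [← sub_add_cancel f g, hq]
      exact add_mem (linForm_mul_mem_prodSpan X hi hq') hg'

theorem powerKer_eq_prodSpan (X : ι → Fin n → ℝ) (S : Finset ι) : powerKer X S = prodSpan X S :=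
  le_antisymm (powerKer_le_prodSpan X S) (prodSpan_le_powerKer X S)

/-- Contraction applies the projection `φ` whose kernel is the line through `X i`. -/
theorem linearIndepOn_insert_iff_contract [DecidableEq ι] {X : ι → Fin n → ℝ} {i : ι}
    {I : Finset ι} (hi : i ∉ I) {w : Fin n → ℝ} (hw : X i ⬝ᵥ w = 1) :
    LinearIndepOn ℝ X ((insert i I : Finset ι) : Set ι) ↔
      LinearIndepOn ℝ (contract X (X i) w) (I : Set ι) := by
  let φ : (Fin n → ℝ) →ₗ[ℝ] (Fin n → ℝ) :=
    { toFun := fun y => y - (y ⬝ᵥ w) • X i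
      map_add' := fun a b => by rw [add_dotProduct]; module
      map_smul' := fun c a => by rw [smul_dotProduct, RingHom.id_apply, smul_eq_mul]; module }
  have hφ : contract X (X i) w = φ ∘ X := rfl
  have hX0 : X i ≠ 0 := by
    rintro h
    simp [h] at hw
  have hφi : φ (X i) = 0 := by
    change X i - (X i ⬝ᵥ w) • X i = 0
    rw [hw, one_smul, sub_self]
  have hrange : Submodule.span ℝ (Set.range fun j : (I : Set ι) => X j) =
      Submodule.span ℝ (X '' I) := by
    rw [Set.image_eq_range]
  rw [Finset.coe_insert, linearIndepOn_insert (by simpa using hi), hφ]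
  constructor
  · rintro ⟨h1, h2⟩
    refine LinearIndependent.map (f := φ) h1 ?_
    rw [hrange, Submodule.disjoint_def]
    intro z hz hz0
    have hz1 : z = (z ⬝ᵥ w) • X i := sub_eq_zero.mp hz0
    by_cases h0 : z ⬝ᵥ w = 0
    · rw [hz1, h0, zero_smul]
    · refine absurd ?_ h2
      rw [hz1] at hz
      exact (Submodule.smul_mem_iff _ h0).mp hz
  · intro h
    refine ⟨LinearIndepOn.of_comp φ h, fun h2 => hX0 ?_⟩
    have hd := Submodule.range_ker_disjoint (f := φ) (v := fun j : (I : Set ι) => X j) h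
    rw [hrange, Submodule.disjoint_def] at hd
    exact hd _ h2 hφi

theorem prodSpan_finite (X : ι → Fin n → ℝ) (S : Finset ι) : FiniteDimensional ℂ (prodSpan X S) := by
  refine FiniteDimensional.span_of_finite ℂ (Set.Finite.image _ ?_)
  exact (Finset.finite_toSet S.powerset).subset fun Y hY => by simpa using hY

/-- Middle exactness: the kernel of the shear consists of multiples of `p_x`, and the quotient is
recognised as a combination of products through `powerKer`. -/
theorem prodSpan_inf_ker_shear [DecidableEq ι] (X : ι → Fin n → ℝ) {S : Finset ι} {i : ι}
    (hi : i ∉ S) (h0 : X i ≠ 0) {w : Fin n → ℝ} (hw : X i ⬝ᵥ w = 1) :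
    prodSpan X (insert i S) ⊓ LinearMap.ker (shear (X i) w).toLinearMap =
      (prodSpan X S).map (LinearMap.mulLeft ℂ (linForm (X i))) := by
  refine le_antisymm ?_ ?_
  · rintro f ⟨hf, hker⟩
    obtain ⟨q, rfl⟩ : linForm (X i) ∣ f := by
      have h := linForm_dvd_sub_shear (X i) w f
      have hker' : shear (X i) w f = 0 := hker
      rwa [hker', sub_zero] at h
    refine ⟨q, ?_, rfl⟩
    have hf' : linForm (X i) * q ∈ prodSpan X (insert i S) := hf
    rw [← powerKer_eq_prodSpan] at hf'
    exact powerKer_le_prodSpan X S (linForm_mul_mem_powerKer hi h0 hf')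
  · rintro _ ⟨q, hq, rfl⟩
    refine ⟨linForm_mul_mem_prodSpan X hi hq, ?_⟩
    change shear (X i) w (linForm (X i) * q) = 0
    rw [map_mul, shear_linForm, hw, one_smul, sub_self, linForm_zero, zero_mul]

theorem map_shear_prodSpan_insert [DecidableEq ι] (X : ι → Fin n → ℝ) {S : Finset ι} {i : ι}
    {w : Fin n → ℝ} (hw : X i ⬝ᵥ w = 1) :
    (prodSpan X (insert i S)).map (shear (X i) w).toLinearMap =
      prodSpan (contract X (X i) w) S := by
  rw [map_shear_prodSpan]
  refine le_antisymm (Submodule.span_le.mpr ?_) (prodSpan_mono _ (Finset.subset_insert i S))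
  rintro _ ⟨Y, hY, rfl⟩
  by_cases hiY : i ∈ Y
  · have h0 : prodForm (contract X (X i) w) Y = 0 := by
      refine Finset.prod_eq_zero hiY ?_
      rw [contract, hw, one_smul, sub_self, linForm_zero]
    rw [h0]
    exact zero_mem _
  · exact prodForm_mem_prodSpan _ ((Finset.subset_insert_iff_of_notMem hiY).mp hY)

open Classical in
-- Rank-nullity for the shear reproduces the recursion for independent sets: those avoiding `i`
-- count the kernel, those containing `i` count the image.
theorem finrank_prodSpan (X : ι → Fin n → ℝ) (S : Finset ι) :
    Module.finrank ℂ (prodSpan X S) =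
      (S.powerset.filter fun I : Finset ι => LinearIndepOn ℝ X (I : Set ι)).card := by
  induction S using Finset.induction_on generalizing X with
  | empty =>
    have h1 : prodSpan X ∅ = Submodule.span ℂ {(1 : Poly n)} := by
      simp [prodSpan, prodForm]
    rw [h1, finrank_span_singleton one_ne_zero]
    rw [Finset.powerset_empty, Finset.filter_singleton, if_pos (by simp), Finset.card_singleton]
  | insert i S hi ih =>
    rw [Finset.card_filter, Finset.sum_powerset_insert hi, ← Finset.card_filter, ← ih X]
    rcases eq_or_ne (X i) 0 with h0 | h0
    · have h1 : prodSpan X (insert i S) = prodSpan X S := by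
        refine le_antisymm (Submodule.span_le.mpr ?_) (prodSpan_mono _ (Finset.subset_insert i S))
        rintro _ ⟨Y, hY, rfl⟩
        by_cases hiY : i ∈ Y
        · have h0 : prodForm X Y = 0 := Finset.prod_eq_zero hiY (by rw [h0, linForm_zero])
          rw [h0]
          exact zero_mem _
        · exact prodForm_mem_prodSpan _ ((Finset.subset_insert_iff_of_notMem hiY).mp hY)
      rw [h1, Finset.sum_eq_zero, add_zero]
      refine fun I _ => if_neg fun h => ?_
      exact h.ne_zero (i := i) (by simp) h0
    · obtain ⟨w, hw⟩ := exists_dotProduct_eq_one h0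
      have hsum : (∑ I ∈ S.powerset, if LinearIndepOn ℝ X ((insert i I : Finset ι) : Set ι)
          then 1 else 0) = Module.finrank ℂ (prodSpan (contract X (X i) w) S) := by
        rw [ih, Finset.card_filter]
        refine Finset.sum_congr rfl fun I hI => ?_
        have hiI : i ∉ I := fun h => hi (Finset.mem_powerset.mp hI h)
        simp only [linearIndepOn_insert_iff_contract hiI hw]
      rw [hsum, ← map_shear_prodSpan_insert X hw]
      have := prodSpan_finite X (insert i S)
      have hrn := LinearMap.finrank_range_add_finrank_ker
        ((shear (X i) w).toLinearMap.domRestrict (prodSpan X (insert i S)))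
      have hker : Module.finrank ℂ (LinearMap.ker
          ((shear (X i) w).toLinearMap.domRestrict (prodSpan X (insert i S)))) =
          Module.finrank ℂ (prodSpan X S) := by
        rw [LinearMap.ker_domRestrict, ← Submodule.finrank_map_subtype_eq,
          Submodule.map_comap_subtype, prodSpan_inf_ker_shear X hi h0 hw]
        refine (LinearEquiv.finrank_eq (Submodule.equivMapOfInjective _ ?_ _)).symm
        exact fun a b h => mul_left_cancel₀ (linForm_ne_zero h0) h
      rw [hker, LinearMap.range_domRestrict] at hrn
      rw [← hrn, add_comm]

/-! ## External bases -/

/-- The indices of the elements of `B₀` that complete the set `s` greedily. -/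
def greedyIndices (B₀ : Module.Basis (Fin n) ℝ (Fin n → ℝ)) (s : Set (Fin n → ℝ)) :
    Set (Fin n) :=
  {k | B₀ k ∉ Submodule.span ℝ (s ∪ B₀ '' {j | j < k})}

theorem span_union_greedyIndices (B₀ : Module.Basis (Fin n) ℝ (Fin n → ℝ))
    (s : Set (Fin n → ℝ)) : Submodule.span ℝ (s ∪ B₀ '' greedyIndices B₀ s) = ⊤ := by
  rw [eq_top_iff, ← B₀.span_eq, Submodule.span_le]
  rintro _ ⟨k, rfl⟩
  induction k using WellFoundedLT.induction with
  | ind k ih =>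
    by_cases hk : k ∈ greedyIndices B₀ s
    · exact Submodule.subset_span (Or.inr ⟨k, hk, rfl⟩)
    · have hk' : B₀ k ∈ Submodule.span ℝ (s ∪ B₀ '' {j | j < k}) := not_not.mp hk
      refine Submodule.span_le.mpr ?_ hk'
      rintro _ (hy | ⟨j, hj, rfl⟩)
      · exact Submodule.subset_span (Or.inl hy)
      · exact ih j hj

theorem coe_greedyExt (X : ι → Fin n → ℝ) (B₀ : Module.Basis (Fin n) ℝ (Fin n → ℝ))
    (I : Finset ι) : (greedyExt X B₀ I : Set (ι ⊕ Fin n)) =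
      Sum.inl '' (I : Set ι) ∪ Sum.inr '' greedyIndices B₀ (X '' (I : Set ι)) := by
  ext (i | k) <;> simp [greedyExt, greedyIndices]

theorem image_augmented (X : ι → Fin n → ℝ) (B₀ : Module.Basis (Fin n) ℝ (Fin n → ℝ))
    (s : Set ι) (t : Set (Fin n)) :
    augmented X B₀ '' (Sum.inl '' s ∪ Sum.inr '' t) = X '' s ∪ B₀ '' t := by
  rw [Set.image_union, Set.image_image, Set.image_image]
  rfl

theorem span_greedyExt (X : ι → Fin n → ℝ) (B₀ : Module.Basis (Fin n) ℝ (Fin n → ℝ))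
    (I : Finset ι) : Submodule.span ℝ (augmented X B₀ '' (greedyExt X B₀ I)) = ⊤ := by
  rw [coe_greedyExt, image_augmented, span_union_greedyIndices]

theorem linearIndepOn_greedyExt {X : ι → Fin n → ℝ} (B₀ : Module.Basis (Fin n) ℝ (Fin n → ℝ))
    {I : Finset ι} (hI : I ∈ indepSets X) :
    LinearIndepOn ℝ (augmented X B₀) (greedyExt X B₀ I : Set (ι ⊕ Fin n)) := by
  set G := greedyIndices B₀ (X '' (I : Set ι))
  -- The accepted elements of `B₀` are added in their order; each lies outside the span of `I` and
  -- all earlier ones. The bound `m = n` gives the whole extension.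
  have key : ∀ m : ℕ, LinearIndepOn ℝ (augmented X B₀)
      (Sum.inl '' (I : Set ι) ∪ Sum.inr '' {k | k ∈ G ∧ k.val < m}) := by
    intro m
    induction m with
    | zero =>
      simp only [Nat.not_lt_zero, and_false, Set.ofPred_false, Set.image_empty, Set.union_empty]
      exact LinearIndepOn.image_of_comp Sum.inl (augmented X B₀) hI
    | succ m ih =>
      by_cases hm : ∃ k : Fin n, k.val = m ∧ k ∈ G
      · obtain ⟨k, hkm, hk⟩ := hm
        have hset : {j | j ∈ G ∧ j.val < m + 1} = insert k {j | j ∈ G ∧ j.val < m} := by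
          ext j
          simp only [Set.mem_ofPred_eq, Set.mem_insert_iff, Fin.ext_iff]
          constructor
          · rintro ⟨h1, h2⟩
            rcases Nat.lt_succ_iff_lt_or_eq.mp h2 with h | h
            · exact Or.inr ⟨h1, h⟩
            · exact Or.inl (h.trans hkm.symm)
          · rintro (h | ⟨h1, h2⟩)
            · rw [Fin.ext h]
              exact ⟨hk, by omega⟩
            · exact ⟨h1, by omega⟩
        rw [hset, Set.image_insert_eq, Set.union_insert, linearIndepOn_insert]
        · refine ⟨ih, fun h => hk ?_⟩
          rw [image_augmented] at h
          refine Submodule.span_mono (Set.union_subset_union_right _ (Set.image_mono ?_)) h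
          exact fun j hj => Fin.lt_def.mpr (hj.2.trans_eq hkm.symm)
        · rintro (⟨_, _, h⟩ | ⟨j, hj, h⟩)
          · cases h
          · cases h
            exact absurd hj.2 (by omega)
      · have hset : {j | j ∈ G ∧ j.val < m + 1} = {j | j ∈ G ∧ j.val < m} := by
          ext j
          refine ⟨fun h => ⟨h.1, ?_⟩, fun h => ⟨h.1, h.2.trans (Nat.lt_succ_self m)⟩⟩
          exact lt_of_le_of_ne (Nat.lt_succ_iff.mp h.2) fun h' => hm ⟨j, h', h.1⟩
        rwa [hset]
  rw [coe_greedyExt]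
  convert! key n using 3
  ext j
  simp [G]

theorem card_greedyExt {X : ι → Fin n → ℝ} (B₀ : Module.Basis (Fin n) ℝ (Fin n → ℝ))
    {I : Finset ι} (hI : I ∈ indepSets X) : (greedyExt X B₀ I).card = n := by
  have hsp : ⊤ ≤ Submodule.span ℝ
      (Set.range fun y : (greedyExt X B₀ I : Set (ι ⊕ Fin n)) => augmented X B₀ y) := by
    rw [← Set.image_eq_range, span_greedyExt]
  have h := Module.finrank_eq_card_basis (Module.Basis.mk (linearIndepOn_greedyExt B₀ hI) hsp)
  simpa using h.symm

theorem exists_vertex {X : ι → Fin n → ℝ} (B₀ : Module.Basis (Fin n) ℝ (Fin n → ℝ))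
    {I : Finset ι} (hI : I ∈ indepSets X) (lam : ι ⊕ Fin n → ℝ) :
    ∃ v, ∀ y ∈ greedyExt X B₀ I, augmented X B₀ y ⬝ᵥ v = lam y := by
  have hsp : ⊤ ≤ Submodule.span ℝ
      (Set.range fun y : (greedyExt X B₀ I : Set (ι ⊕ Fin n)) => augmented X B₀ y) := by
    rw [← Set.image_eq_range, span_greedyExt]
  let b := Module.Basis.mk (linearIndepOn_greedyExt B₀ hI) hsp
  obtain ⟨v, hv⟩ := exists_dotProduct_eq
    (b.constr ℝ fun y : (greedyExt X B₀ I : Set (ι ⊕ Fin n)) => lam y)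
  refine ⟨v, fun y hy => ?_⟩
  have h := b.constr_basis ℝ (fun y : (greedyExt X B₀ I : Set (ι ⊕ Fin n)) => lam y) ⟨y, hy⟩
  rwa [show b ⟨y, hy⟩ = augmented X B₀ y from Module.Basis.mk_apply _ _ _, ← hv] at h

theorem greedyExt_injective (X : ι → Fin n → ℝ) (B₀ : Module.Basis (Fin n) ℝ (Fin n → ℝ)) :
    Function.Injective (greedyExt X B₀) := by
  intro I I' h
  ext i
  have h1 : Sum.inl i ∈ greedyExt X B₀ I ↔ Sum.inl i ∈ greedyExt X B₀ I' := by rw [h]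
  simpa [greedyExt] using h1

/-- For each `S` with `n + 1` members the bad parameters form a proper subspace, since a linear map
from `ℝ^n` to `ℝ^S` is not onto. Finitely many proper subspaces do not cover a real vector space. -/
theorem exists_isGeneric {κ : Type*} [Finite κ] (X : κ → Fin n → ℝ) : ∃ lam, IsGeneric X lam := by
  classical
  have := Fintype.ofFinite κ
  let A (S : Finset κ) : (Fin n → ℝ) →ₗ[ℝ] (S → ℝ) :=
    LinearMap.pi fun y => dotProductBilin ℝ ℝ (X y)
  let W (S : {S : Finset κ // S.card = n + 1}) : Submodule ℝ (κ → ℝ) :=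
    (LinearMap.range (A S)).comap (LinearMap.funLeft ℝ ℝ Subtype.val)
  have hW : ∀ S, W S ≠ ⊤ := by
    rintro ⟨S, hS⟩ h
    have hsurj : Function.Surjective (A S) := by
      intro μ
      have hμ : (fun y => if h : y ∈ S then μ ⟨y, h⟩ else 0 : κ → ℝ) ∈ W ⟨S, hS⟩ := by
        rw [h]; trivial
      obtain ⟨v, hv⟩ := hμ
      refine ⟨v, hv.trans ?_⟩
      ext ⟨y, hy⟩
      simp [LinearMap.funLeft_apply, hy]
    have h1 := LinearMap.finrank_le_finrank_of_surjective hsurj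
    simp [hS] at h1
  have hcov : ⋃ S, (W S : Set (κ → ℝ)) ≠ Set.univ := fun h => by
    obtain ⟨S, hS⟩ := Subspace.exists_eq_top_of_iUnion_eq_univ h
    exact hW S hS
  obtain ⟨lam, hlam⟩ := (Set.ne_univ_iff_exists_notMem _).mp hcov
  refine ⟨lam, fun S hS ⟨v, hv⟩ => hlam (Set.mem_iUnion.mpr ⟨⟨S, hS⟩, v, ?_⟩)⟩
  ext ⟨y, hy⟩
  exact hv y hy

/-! ## The decomposition of the polynomials -/

theorem PPlus_eq_prodSpan [Fintype ι] (X : ι → Fin n → ℝ) : PPlus X = prodSpan X Finset.univ := by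
  rw [PPlus, prodSpan, ← Set.image_univ]
  simp

theorem finrank_PPlus [Finite ι] (X : ι → Fin n → ℝ) :
    Module.finrank ℂ (PPlus X) = (indepSets X).ncard := by
  classical
  have := Fintype.ofFinite ι
  rw [PPlus_eq_prodSpan, finrank_prodSpan, ← Set.ncard_coe_finset]
  congr 1
  ext I
  simp only [Finset.powerset_univ, Finset.coe_filter, Finset.mem_univ, true_and]
  rfl

theorem finiteDimensional_PPlus [Finite ι] (X : ι → Fin n → ℝ) :
    FiniteDimensional ℂ (PPlus X) :=
  FiniteDimensional.span_of_finite ℂ (Set.finite_range _)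

/-- An independent set `I` that misses `Y` lies in its complement, so an element `B₀ k` accepted
after the complement is also accepted after the smaller set `I`. -/
theorem disjSum_singleton_mem_externalLong {X : ι → Fin n → ℝ}
    {B₀ : Module.Basis (Fin n) ℝ (Fin n → ℝ)} {Y : Finset ι} {k : Fin n}
    (hk : k ∈ greedyIndices B₀ (X '' (Y : Set ι)ᶜ)) :
    Y.disjSum {k} ∈ externalLong X B₀ := by
  rintro _ ⟨I, -, rfl⟩
  by_cases h : ∃ i ∈ Y, i ∈ I
  · obtain ⟨i, hY, hI⟩ := h
    exact ⟨Sum.inl i, by simpa using hY, by simpa [greedyExt] using hI⟩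
  · refine ⟨Sum.inr k, by simp, ?_⟩
    simp only [greedyExt, Finset.inr_mem_disjSum, Finset.mem_filter, Finset.mem_univ, true_and]
    refine fun hI => hk (Submodule.span_mono (Set.union_subset_union_left _ (Set.image_mono ?_)) hI)
    exact fun i hi hY => h ⟨i, hY, hi⟩

/-- Induction on the number of members of `X` outside `Y`. Those members and their greedy completion
span the space, so a variable factor of `h` splits into forms of two kinds: one from `X` outside `Y`
enlarges `Y`, one from `B₀` moves the product into `J_+`. -/
theorem prodForm_mul_mem_sup [Finite ι] (X : ι → Fin n → ℝ)
    (B₀ : Module.Basis (Fin n) ℝ (Fin n → ℝ)) (Y : Finset ι) (h : Poly n) :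
    prodForm X Y * h ∈ PPlus X ⊔ (JPlus X B₀).restrictScalars ℂ := by
  classical
  have := Fintype.ofFinite ι
  induction hc : Yᶜ.card using Nat.strong_induction_on generalizing Y h with
  | _ c ih =>
    induction h using MvPolynomial.induction_on with
    | C a =>
      rw [mul_comm, ← smul_eq_C_mul]
      exact Submodule.smul_mem _ _ (Submodule.mem_sup_left (Submodule.subset_span ⟨Y, rfl⟩))
    | add p q hp hq => rw [mul_add]; exact add_mem hp hq
    | mul_X p i _ =>
      rw [← linForm_single, mul_comm p]
      have hi : Pi.single i (1 : ℝ) ∈ Submodule.span ℝ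
          (X '' (Y : Set ι)ᶜ ∪ B₀ '' greedyIndices B₀ (X '' (Y : Set ι)ᶜ)) := by
        rw [span_union_greedyIndices]; trivial
      generalize (Pi.single i 1 : Fin n → ℝ) = v at hi ⊢
      induction hi using Submodule.span_induction with
      | mem v hv =>
        rcases hv with ⟨j, hj, rfl⟩ | ⟨k, hk, rfl⟩
        · have hj' : j ∉ Y := hj
          have h1 : prodForm X Y * (linForm (X j) * p) = prodForm X (insert j Y) * p := by
            rw [prodForm, prodForm, Finset.prod_insert hj']
            ring
          rw [h1]
          refine ih _ ?_ _ _ rfl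
          rw [← hc]
          refine Finset.card_lt_card (Finset.compl_ssubset_compl.mpr (Finset.ssubset_insert hj'))
        · refine Submodule.mem_sup_right ?_
          have h1 : prodForm X Y * (linForm (B₀ k) * p) =
              p * prodForm (augmented X B₀) (Y.disjSum {k}) := by
            rw [prodForm, prodForm, Finset.prod_disjSum, Finset.prod_singleton]
            simp only [augmented, Sum.elim_inl, Sum.elim_inr]
            ring
          rw [h1]
          exact Ideal.mul_mem_left _ _
            (Ideal.subset_span ⟨_, disjSum_singleton_mem_externalLong hk, rfl⟩)
      | zero => rw [linForm_zero, zero_mul, mul_zero]; exact zero_mem _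
      | add u v _ _ hu hv => rw [linForm_add, add_mul, mul_add]; exact add_mem hu hv
      | smul a u _ hu =>
        rw [linForm_smul, mul_assoc, mul_left_comm, ← smul_eq_C_mul]
        exact Submodule.smul_mem _ _ hu

theorem PPlus_sup_JPlus [Finite ι] (X : ι → Fin n → ℝ)
    (B₀ : Module.Basis (Fin n) ℝ (Fin n → ℝ)) :
    PPlus X ⊔ (JPlus X B₀).restrictScalars ℂ = ⊤ := by
  refine eq_top_iff.mpr fun h _ => ?_
  have := prodForm_mul_mem_sup X B₀ ∅ h
  rwa [prodForm, Finset.prod_empty, one_mul] at this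

/-! ## Duality -/

/-- A series is orthogonal to an ideal if and only if the generators, as differential operators,
annihilate it. -/
theorem forall_mem_span_pairing_eq_zero {G : Set (Poly n)} {f : Series n} :
    (∀ q ∈ Ideal.span G, pairing q f = 0) ↔ ∀ g ∈ G, diffOp n g f = 0 := by
  constructor
  · refine fun h g hg => eq_zero_of_forall_pairing fun a => ?_
    rw [← pairing_mul]
    exact h _ (Ideal.mul_mem_left _ _ (Ideal.subset_span hg))
  · intro h q hq
    suffices diffOp n q f = 0 by rw [pairing, LinearMap.comp_apply, this, map_zero]
    induction hq using Submodule.span_induction with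
    | mem q hq => exact h q hq
    | zero => rw [map_zero, LinearMap.zero_apply]
    | add p q _ _ hp hq => rw [map_add, LinearMap.add_apply, hp, hq, add_zero]
    | smul a q _ hq => rw [smul_eq_mul, diffOp_mul, Module.End.mul_apply, hq, map_zero]

theorem mem_DPlus_iff_JPlus {X : ι → Fin n → ℝ} {B₀ : Module.Basis (Fin n) ℝ (Fin n → ℝ)}
    {f : Poly n} : f ∈ DPlus X B₀ ↔ ∀ q ∈ JPlus X B₀, pairing q (toSeries n f) = 0 := by
  rw [JPlus, forall_mem_span_pairing_eq_zero, Set.forall_mem_image]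
  simp only [DPlus, Submodule.mem_iInf, LinearMap.mem_ker, LinearMap.comp_apply]

/-- Such an `f` is orthogonal to `P_+` and to `J_+`, hence to all polynomials. -/
theorem eq_zero_of_mem_DPlus [Finite ι] {X : ι → Fin n → ℝ}
    {B₀ : Module.Basis (Fin n) ℝ (Fin n → ℝ)} {f : Poly n} (hf : f ∈ DPlus X B₀)
    (h : ∀ p ∈ PPlus X, pairing p (toSeries n f) = 0) : f = 0 := by
  refine toSeries_injective n ((eq_zero_of_forall_pairing fun p => ?_).trans (map_zero _).symm)
  have hp : p ∈ PPlus X ⊔ (JPlus X B₀).restrictScalars ℂ := by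
    rw [PPlus_sup_JPlus]; trivial
  obtain ⟨a, ha, b, hb, rfl⟩ := Submodule.mem_sup.mp hp
  rw [pairing_add, h a ha, mem_DPlus_iff_JPlus.mp hf b hb, add_zero]

/-- `pairingMap` as a linear map. -/
def pairingLinear (D P : Submodule ℂ (Poly n)) : D →ₗ[ℂ] Module.Dual ℂ P where
  toFun := pairingMap D P
  map_add' _ _ := LinearMap.ext fun _ => pairing_add _ _ _
  map_smul' _ _ := LinearMap.ext fun _ => pairing_smul _ _ _

theorem pairingLinear_injective [Finite ι] (X : ι → Fin n → ℝ)
    (B₀ : Module.Basis (Fin n) ℝ (Fin n → ℝ)) :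
    Function.Injective (pairingLinear (DPlus X B₀) (PPlus X)) := by
  rw [← LinearMap.ker_eq_bot, LinearMap.ker_eq_bot']
  refine fun f hf => Subtype.ext (eq_zero_of_mem_DPlus f.2 fun p hp => ?_)
  rw [pairing_poly_comm]
  exact LinearMap.congr_fun hf ⟨p, hp⟩

theorem finiteDimensional_DPlus [Finite ι] (X : ι → Fin n → ℝ)
    (B₀ : Module.Basis (Fin n) ℝ (Fin n → ℝ)) : FiniteDimensional ℂ (DPlus X B₀) :=
  have := finiteDimensional_PPlus X
  FiniteDimensional.of_injective _ (pairingLinear_injective X B₀)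

theorem finrank_DPlus_le [Finite ι] (X : ι → Fin n → ℝ)
    (B₀ : Module.Basis (Fin n) ℝ (Fin n → ℝ)) :
    Module.finrank ℂ (DPlus X B₀) ≤ Module.finrank ℂ (PPlus X) := by
  have := finiteDimensional_PPlus X
  rw [← Subspace.dual_finrank_eq (V := PPlus X)]
  exact LinearMap.finrank_le_finrank_of_injective (pairingLinear_injective X B₀)

/-! ## Least spaces -/

/-- The inhomogeneous product `∏ (p_y - lam_y)`, `y ∈ Y`. -/
def affineForm (X : ι → Fin n → ℝ) (lam : ι → ℝ) (Y : Finset ι) : Poly n :=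
  ∏ y ∈ Y, (linForm (X y) - C (lam y : ℂ))

theorem linForm_isHomogeneous (x : Fin n → ℝ) : (linForm x).IsHomogeneous 1 :=
  IsHomogeneous.sum _ _ _ fun i _ => isHomogeneous_C_mul_X _ i

theorem prodForm_isHomogeneous (X : ι → Fin n → ℝ) (Y : Finset ι) :
    (prodForm X Y).IsHomogeneous Y.card := by
  have h := IsHomogeneous.prod Y (fun y => linForm (X y)) (fun _ => 1)
    fun y _ => linForm_isHomogeneous (X y)
  simpa [prodForm] using h

/-- The constants `lam y` only affect lower degrees. The homogeneous factor `q` is general so that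
the induction can absorb linear forms into it. -/
theorem homogeneousComponent_mul_affineForm (X : ι → Fin n → ℝ) (lam : ι → ℝ) (Y : Finset ι)
    {q : Poly n} {e : ℕ} (hq : q.IsHomogeneous e) :
    homogeneousComponent (e + Y.card) (q * affineForm X lam Y) = q * prodForm X Y ∧
      (q * affineForm X lam Y).totalDegree ≤ e + Y.card := by
  classical
  induction Y using Finset.induction_on generalizing q e with
  | empty => simpa [affineForm, prodForm] using
      ⟨homogeneousComponent_eq_self hq, hq.totalDegree_le⟩
  | insert i Y hi ih =>
    have h1 : q * affineForm X lam (insert i Y) = q * linForm (X i) * affineForm X lam Y -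
        C (lam i : ℂ) * (q * affineForm X lam Y) := by
      rw [affineForm, Finset.prod_insert hi, ← affineForm]
      ring
    have h2 : q * prodForm X (insert i Y) = q * linForm (X i) * prodForm X Y := by
      rw [prodForm, Finset.prod_insert hi, ← prodForm, mul_assoc]
    obtain ⟨h3, h4⟩ := ih (hq.mul (linForm_isHomogeneous (X i)))
    obtain ⟨-, h5⟩ := ih hq
    have h6 : (C (lam i : ℂ) * (q * affineForm X lam Y)).totalDegree ≤ e + Y.card := by
      rw [← smul_eq_C_mul]
      exact (totalDegree_smul_le _ _).trans h5
    have hcard : e + (insert i Y).card = e + 1 + Y.card := by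
      rw [Finset.card_insert_of_notMem hi]; ring
    rw [h1, h2, hcard]
    refine ⟨?_, (totalDegree_sub _ _).trans (max_le h4 (by omega))⟩
    rw [map_sub, h3, homogeneousComponent_eq_zero _ _ (by omega), sub_zero]

theorem eval_linForm (x v : Fin n → ℝ) :
    eval (fun i => (v i : ℂ)) (linForm x) = ((x ⬝ᵥ v : ℝ) : ℂ) := by
  simp [linForm, dotProduct]

theorem pairing_eq_zero_of_mem_expSpace {σ : Set (Fin n → ℂ)} {p : Poly n}
    (hp : ∀ α ∈ σ, eval α p = 0) {f : Series n} (hf : f ∈ expSpace σ) : pairing p f = 0 := by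
  induction hf using Submodule.span_induction with
  | mem f hf =>
    obtain ⟨α, hα, rfl⟩ := hf
    rw [pairing_expSeries, hp α hα]
  | zero => exact map_zero _
  | add f g _ _ hf hg => rw [map_add, hf, hg, add_zero]
  | smul c f _ hf => rw [map_smul, hf, smul_zero]

/-- For long `Y` the affine product vanishes at every vertex, so its multiples are orthogonal to `f`
in the exponential space. When its degree is the order of `f`, such a multiple pairs with `f` as its
leading form `t^m p_Y` pairs with the least term of `f`; in other degrees the pairing is zero by
homogeneity. -/
theorem leastSpace_le_DPlus (X : ι → Fin n → ℝ) (B₀ : Module.Basis (Fin n) ℝ (Fin n → ℝ))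
    (lam : ι ⊕ Fin n → ℝ) : leastSpace (externalVertices X B₀ lam) ≤ DPlus X B₀ := by
  refine Submodule.span_le.mpr ?_
  rintro _ ⟨f, hf, rfl⟩
  rw [SetLike.mem_coe, mem_DPlus_iff_JPlus, JPlus, forall_mem_span_pairing_eq_zero,
    Set.forall_mem_image]
  refine fun Y hY => eq_zero_of_forall_pairing fun a => ?_
  rw [← pairing_mul]
  induction a using MvPolynomial.induction_on' with
  | add a b ha hb => rw [add_mul, pairing_add, ha, hb, add_zero]
  | monomial m c =>
    have hm : (monomial m c : Poly n).IsHomogeneous m.degree := isHomogeneous_monomial c rfl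
    by_cases hd : m.degree + Y.card = f.order.toNat
    · obtain ⟨h1, h2⟩ := homogeneousComponent_mul_affineForm (augmented X B₀) lam Y hm
      rw [← h1, hd, pairing_homogeneousComponent (leastTerm_isHomogeneous f),
        pairing_leastTerm (hd ▸ h2)]
      refine pairing_eq_zero_of_mem_expSpace ?_ hf
      rintro _ ⟨v, ⟨B, hB, hv⟩, rfl⟩
      obtain ⟨y, hyY, hyB⟩ := hY B hB
      rw [map_mul, affineForm, map_prod, Finset.prod_eq_zero hyY, mul_zero]
      rw [map_sub, eval_linForm, eval_C, hv y hyB, sub_self]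
    · exact pairing_eq_zero_of_isHomogeneous (hm.mul (prodForm_isHomogeneous _ Y))
        (leastTerm_isHomogeneous f) hd

theorem conj_expSeries {α : Fin n → ℂ} (hα : ∀ i, starRingEnd ℂ (α i) = α i) :
    MvPowerSeries.map (starRingEnd ℂ) (expSeries α) = expSeries α := by
  refine MvPowerSeries.ext fun m => ?_
  rw [MvPowerSeries.coeff_map]
  change starRingEnd ℂ (∏ i, α i ^ m i / ((m i).factorial : ℂ)) =
    ∏ i, α i ^ m i / ((m i).factorial : ℂ)
  simp [map_prod, hα]

theorem leastTerm_conj (f : Series n) :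
    leastTerm (MvPowerSeries.map (starRingEnd ℂ) f) = conjPoly (leastTerm f) := by
  have ho : (MvPowerSeries.map (starRingEnd ℂ) f).order = f.order := by
    refine le_antisymm ?_ (MvPowerSeries.le_order_map _)
    refine (MvPowerSeries.le_order_map (starRingEnd ℂ)).trans_eq ?_
    congr 1
    exact MvPowerSeries.ext fun m => by simp
  ext m
  rw [conjPoly, coeff_map, coeff_leastTerm, coeff_leastTerm, ho, MvPowerSeries.coeff_map]
  split_ifs <;> simp

theorem conj_mem_leastSpace {σ : Set (Fin n → ℂ)}
    (hσ : ∀ α ∈ σ, ∀ i, starRingEnd ℂ (α i) = α i) {p : Poly n} (hp : p ∈ leastSpace σ) :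
    conjPoly p ∈ leastSpace σ := by
  have hexp : ∀ f ∈ expSpace σ, MvPowerSeries.map (starRingEnd ℂ) f ∈ expSpace σ := by
    intro f hf
    induction hf using Submodule.span_induction with
    | mem f hf =>
      obtain ⟨α, hα, rfl⟩ := hf
      rw [conj_expSeries (hσ α hα)]
      exact Submodule.subset_span ⟨α, hα, rfl⟩
    | zero => rw [map_zero]; exact zero_mem _
    | add f g _ _ hf hg => rw [map_add]; exact add_mem hf hg
    | smul c f _ hf =>
      rw [MvPowerSeries.smul_eq_C_mul, map_mul, MvPowerSeries.map_C, ← MvPowerSeries.smul_eq_C_mul]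
      exact Submodule.smul_mem _ _ hf
  induction hp using Submodule.span_induction with
  | mem p hp =>
    obtain ⟨f, hf, rfl⟩ := hp
    rw [← leastTerm_conj]
    exact Submodule.subset_span ⟨_, hexp f hf, rfl⟩
  | zero => rw [map_zero]; exact zero_mem _
  | add p q _ _ hp hq => rw [map_add]; exact add_mem hp hq
  | smul c p _ hp =>
    rw [smul_eq_C_mul, map_mul, conjPoly, map_C, ← smul_eq_C_mul]
    exact Submodule.smul_mem _ _ hp

/-- Through the pairing, exponentials become evaluations, which are distinct multiplicative
characters of `Poly n`; Dedekind's theorem applies. -/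
theorem linearIndependent_expSeries (σ : Set (Fin n → ℂ)) :
    LinearIndependent ℂ fun α : σ => expSeries (α : Fin n → ℂ) := by
  let T : Series n →ₗ[ℂ] (Poly n → ℂ) := LinearMap.pi fun p => pairing p
  refine LinearIndependent.of_comp T ?_
  have h := (linearIndependent_monoidHom (Poly n) ℂ).comp
    (fun α : σ => ((eval (α : Fin n → ℂ) : Poly n →+* ℂ) : Poly n →* ℂ)) fun α β h => by
      refine Subtype.ext (funext fun i => ?_)
      simpa using DFunLike.congr_fun h (X i)
  have hT : (T ∘ fun α : σ => expSeries (α : Fin n → ℂ)) = fun (α : σ) (p : Poly n) =>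
      eval (α : Fin n → ℂ) p := funext fun α => funext fun p => pairing_expSeries p α
  rw [hT]
  exact h

/-- A set of real points has no more points than the dimension of its least space. -/
theorem finite_and_card_le_finrank_leastSpace {σ : Set (Fin n → ℂ)}
    (hσ : ∀ α ∈ σ, ∀ i, starRingEnd ℂ (α i) = α i) [FiniteDimensional ℂ (leastSpace σ)] :
    σ.Finite ∧ Nat.card σ ≤ Module.finrank ℂ (leastSpace σ) := by
  let T : Series n →ₗ[ℂ] Module.Dual ℂ (leastSpace σ) :=
    { toFun := fun f => pairingLeft f ∘ₗ (leastSpace σ).subtype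
      map_add' := fun f g => LinearMap.ext fun p => map_add (pairing (p : Poly n)) f g
      map_smul' := fun c f => LinearMap.ext fun p => map_smul (pairing (p : Poly n)) c f }
  have hT : LinearIndependent ℂ fun α : σ => T (expSeries (α : Fin n → ℂ)) := by
    refine LinearIndependent.map (f := T) (linearIndependent_expSeries σ) ?_
    rw [Submodule.disjoint_def]
    intro f hf hTf
    have hf' : f ∈ expSpace σ := by
      rwa [expSpace, Set.image_eq_range]
    -- A nonzero `f` is detected by the conjugate of its least term, which lies in the least space
    -- because the points are real. Hence `T` is injective on the exponential space.
    by_contra h0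
    refine leastTerm_ne_zero h0 (eq_zero_of_pairing_conj_self ?_)
    rw [pairing_leastTerm]
    · exact LinearMap.congr_fun hTf ⟨conjPoly (leastTerm f),
        conj_mem_leastSpace hσ (Submodule.subset_span ⟨f, hf', rfl⟩)⟩
    · exact ((leastTerm_isHomogeneous f).map _).totalDegree_le
  have hfin : Finite σ := hT.finite_of_isNoetherian
  have := Fintype.ofFinite σ
  refine ⟨Set.toFinite σ, ?_⟩
  rw [Nat.card_eq_fintype_card, ← Subspace.dual_finrank_eq (V := leastSpace σ)]
  exact hT.fintype_card_le_finrank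

/-! ## Correctness -/

/-- If `p` vanishes on `σ`, it is orthogonal to the exponential space. Its leading form pairs with a
least term of the same degree as `p` does with the series, that is to zero, and with other least
terms to zero by degree. So the leading form vanishes by `hperp`. -/
theorem eq_zero_of_eval_eq_zero {σ : Set (Fin n → ℂ)} {M : Submodule ℂ (Poly n)}
    (hM : ∀ p ∈ M, ∀ k, homogeneousComponent k p ∈ M)
    (hperp : ∀ p ∈ M, (∀ f ∈ leastSpace σ, pairing p (toSeries n f) = 0) → p = 0)
    {p : Poly n} (hp : p ∈ M) (hσ : ∀ α ∈ σ, eval α p = 0) : p = 0 := by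
  set d := p.totalDegree with hd
  have htop : homogeneousComponent d p = 0 := by
    refine hperp _ (hM p hp d) fun f hf => ?_
    induction hf using Submodule.span_induction with
    | mem f hf =>
      obtain ⟨g, hg, rfl⟩ := hf
      by_cases h : d = g.order.toNat
      · rw [h, pairing_homogeneousComponent (leastTerm_isHomogeneous g), pairing_leastTerm h.le]
        exact pairing_eq_zero_of_mem_expSpace hσ hg
      · exact pairing_eq_zero_of_isHomogeneous (homogeneousComponent_isHomogeneous d p)
          (leastTerm_isHomogeneous g) h
    | zero => rw [map_zero, map_zero]
    | add f g _ _ hf hg => rw [map_add, map_add, hf, hg, add_zero]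
    | smul c f _ hf => rw [map_smul, map_smul, hf, smul_zero]
  by_contra h0
  obtain ⟨m, hm, hmd⟩ := Finset.exists_mem_eq_sup p.support (support_nonempty.mpr h0)
    fun m => m.sum fun _ e => e
  have hdeg : m.degree = d := by
    rw [hd, totalDegree, hmd, Finsupp.degree_eq_sum, Finsupp.sum_fintype _ _ fun _ => rfl]
  have := congrArg (coeff m) htop
  rw [coeff_homogeneousComponent, if_pos hdeg, coeff_zero] at this
  exact mem_support_iff.mp hm this

theorem isCorrect_of_finrank_eq {σ : Set (Fin n → ℂ)} (hfin : σ.Finite) {M : Submodule ℂ (Poly n)}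
    [FiniteDimensional ℂ M] (hrank : Module.finrank ℂ M = Nat.card σ)
    (hM : ∀ p ∈ M, ∀ k, homogeneousComponent k p ∈ M)
    (hperp : ∀ p ∈ M, (∀ f ∈ leastSpace σ, pairing p (toSeries n f) = 0) → p = 0) :
    IsCorrect σ M := by
  have := hfin.fintype
  let E : M →ₗ[ℂ] (σ → ℂ) :=
    LinearMap.pi fun α => (aeval (α : Fin n → ℂ)).toLinearMap ∘ₗ M.subtype
  have hE : ∀ p α, E p α = eval (α : Fin n → ℂ) (p : Poly n) := fun p α => rfl
  have hinj : Function.Injective E := by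
    rw [← LinearMap.ker_eq_bot, LinearMap.ker_eq_bot']
    refine fun p hp => Subtype.ext (eq_zero_of_eval_eq_zero hM hperp p.2 fun α hα => ?_)
    rw [← hE p ⟨α, hα⟩, hp]
    rfl
  have hsurj : Function.Surjective E :=
    (LinearMap.injective_iff_surjective_of_finrank_eq_finrank (by
      rw [hrank, Module.finrank_fintype_fun_eq_card, Nat.card_eq_fintype_card])).mp hinj
  exact ⟨hinj, hsurj⟩

theorem homogeneousComponent_mem_span {G : Set (Poly n)}
    (hG : ∀ g ∈ G, ∃ d, g.IsHomogeneous d) {p : Poly n} (hp : p ∈ Submodule.span ℂ G) (k : ℕ) :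
    homogeneousComponent k p ∈ Submodule.span ℂ G := by
  induction hp using Submodule.span_induction with
  | mem p hp =>
    obtain ⟨d, hd⟩ := hG p hp
    rw [homogeneousComponent_of_mem ((mem_homogeneousSubmodule d p).mpr hd)]
    split_ifs
    · exact Submodule.subset_span hp
    · exact zero_mem _
  | zero => rw [map_zero]; exact zero_mem _
  | add p q _ _ hp hq => rw [map_add]; exact add_mem hp hq
  | smul c p _ hp => rw [map_smul]; exact Submodule.smul_mem _ _ hp

theorem homogeneousComponent_mem_PPlus (X : ι → Fin n → ℝ) {p : Poly n} (hp : p ∈ PPlus X)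
    (k : ℕ) : homogeneousComponent k p ∈ PPlus X := by
  refine homogeneousComponent_mem_span ?_ hp k
  rintro _ ⟨Y, rfl⟩
  exact ⟨_, prodForm_isHomogeneous X Y⟩

theorem homogeneousComponent_mem_leastSpace {σ : Set (Fin n → ℂ)} {p : Poly n}
    (hp : p ∈ leastSpace σ) (k : ℕ) : homogeneousComponent k p ∈ leastSpace σ := by
  refine homogeneousComponent_mem_span ?_ hp k
  rintro _ ⟨f, -, rfl⟩
  exact ⟨_, leastTerm_isHomogeneous f⟩

/-! ## Kernels of ideals with the origin as only zero -/

/-- With the origin as the only zero, the exponential factor is always `1`, and the kernel consists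
of the polynomials orthogonal to the ideal. -/
theorem idealKer_eq_map {I : Ideal (Poly n)} {M : Submodule ℂ (Poly n)}
    (h0 : ∀ q ∈ I, eval 0 q = 0) (hI : ∀ α : Fin n → ℂ, (∀ q ∈ I, eval α q = 0) → α = 0)
    (hM : ∀ f, f ∈ M ↔ ∀ q ∈ I, pairing q (toSeries n f) = 0) :
    M.map (toSeries n) = idealKer I := by
  refine le_antisymm ?_ (Submodule.span_le.mpr ?_)
  · rintro _ ⟨f, hf, rfl⟩
    refine Submodule.subset_span ⟨0, h0, f, ?_, (hM f).mp hf⟩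
    rw [expSeries_zero, one_mul]
  · rintro _ ⟨α, hα, p, rfl, hp⟩
    obtain rfl := hI α hα
    rw [expSeries_zero, one_mul] at hp ⊢
    exact ⟨p, (hM p).mpr hp, rfl⟩

theorem eval_eq_zero_of_mem_span {G : Set (Poly n)} {α : Fin n → ℂ} (h : ∀ g ∈ G, eval α g = 0)
    {q : Poly n} (hq : q ∈ Ideal.span G) : eval α q = 0 := by
  have hle : Ideal.span G ≤ RingHom.ker (eval α) := Ideal.span_le.mpr h
  exact hle hq

theorem eval_zero_linForm (x : Fin n → ℝ) : eval 0 (linForm x) = 0 := by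
  simp [linForm]

theorem eval_linForm_eq_zero {x : Fin n → ℝ} {α : Fin n → ℂ} : eval α (linForm x) = 0 ↔
    (x ⬝ᵥ fun i => (α i).re) = 0 ∧ (x ⬝ᵥ fun i => (α i).im) = 0 := by
  rw [Complex.ext_iff]
  simp [linForm, dotProduct]

theorem eq_zero_of_forall_dotProduct {s : Set (Fin n → ℝ)} (hs : Submodule.span ℝ s = ⊤)
    {v : Fin n → ℝ} (h : ∀ x ∈ s, x ⬝ᵥ v = 0) : v = 0 :=
  dotProduct_self_eq_zero.mp (dotProduct_eq_zero_of_mem_span h (by rw [hs]; trivial))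

theorem eq_zero_of_re_im {α : Fin n → ℂ} (hr : (fun i => (α i).re) = 0)
    (hi : (fun i => (α i).im) = 0) : α = 0 :=
  funext fun i => Complex.ext (congrFun hr i) (congrFun hi i)

theorem map_DPlus_eq_idealKer [Finite ι] (X : ι → Fin n → ℝ)
    (B₀ : Module.Basis (Fin n) ℝ (Fin n → ℝ)) :
    (DPlus X B₀).map (toSeries n) = idealKer (JPlus X B₀) := by
  classical
  have := Fintype.ofFinite ι
  refine idealKer_eq_map (fun q hq => eval_eq_zero_of_mem_span ?_ hq) (fun α hα => ?_)
    fun f => mem_DPlus_iff_JPlus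
  · rintro _ ⟨Y, hY, rfl⟩
    -- A long set is nonempty because it meets the greedy extension of `∅`.
    obtain ⟨y, hy, -⟩ := hY _ ⟨∅, by simp [indepSets], rfl⟩
    rw [prodForm, map_prod, Finset.prod_eq_zero hy (eval_zero_linForm _)]
  -- The forms not vanishing at a common zero `α` have nonzero product there, so they are not long
  -- and miss some external basis. All forms of that basis vanish at `α`, hence at its real and
  -- imaginary parts.
  · have hY : (Finset.univ.filter fun y => eval α (linForm (augmented X B₀ y)) ≠ 0) ∉
        externalLong X B₀ := fun h => by
      have h1 := hα _ (Ideal.subset_span ⟨_, h, rfl⟩)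
      rw [prodForm, map_prod, Finset.prod_eq_zero_iff] at h1
      obtain ⟨y, hy, hy0⟩ := h1
      exact (Finset.mem_filter.mp hy).2 hy0
    simp only [externalLong, Set.mem_ofPred_eq, not_forall, Finset.mem_filter, Finset.mem_univ,
      true_and, not_exists, not_and] at hY
    obtain ⟨_, ⟨I, -, rfl⟩, hI⟩ := hY
    have hz : ∀ y ∈ greedyExt X B₀ I, eval α (linForm (augmented X B₀ y)) = 0 :=
      fun y hy => by_contra fun h => hI y h hy
    refine eq_zero_of_re_im (eq_zero_of_forall_dotProduct (span_greedyExt X B₀ I) ?_)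
      (eq_zero_of_forall_dotProduct (span_greedyExt X B₀ I) ?_)
    · rintro _ ⟨y, hy, rfl⟩
      exact (eval_linForm_eq_zero.mp (hz y hy)).1
    · rintro _ ⟨y, hy, rfl⟩
      exact (eval_linForm_eq_zero.mp (hz y hy)).2

/-! ## The power ideal of the facet hyperplanes -/

/-- The hyperplane orthogonal to `η`. -/
def orthHyperplane (η : Fin n → ℝ) : Submodule ℝ (Fin n → ℝ) :=
  LinearMap.ker ((dotProductBilin ℝ ℝ).flip η : (Fin n → ℝ) →ₗ[ℝ] ℝ)

theorem mem_orthHyperplane {η z : Fin n → ℝ} : z ∈ orthHyperplane η ↔ z ⬝ᵥ η = 0 := Iff.rfl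

theorem finrank_orthHyperplane {η : Fin n → ℝ} (hη : η ≠ 0) :
    Module.finrank ℝ (orthHyperplane η) + 1 = n := by
  have hsurj : Function.Surjective ((dotProductBilin ℝ ℝ).flip η : (Fin n → ℝ) →ₗ[ℝ] ℝ) := by
    refine LinearMap.surjective fun h => hη (dotProduct_self_eq_zero.mp ?_)
    exact LinearMap.congr_fun h η
  have h := LinearMap.finrank_range_add_finrank_ker
    ((dotProductBilin ℝ ℝ).flip η : (Fin n → ℝ) →ₗ[ℝ] ℝ)
  rw [LinearMap.range_eq_top.mpr hsurj, finrank_top, Module.finrank_self,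
    Module.finrank_fin_fun] at h
  rw [orthHyperplane, add_comm, h]

theorem orthHyperplane_mem_facetHyperplanes {X : ι → Fin n → ℝ} {η : Fin n → ℝ} (hη : η ≠ 0)
    (h : ∀ z, z ⬝ᵥ η = 0 → z ∈ Submodule.span ℝ (Set.range X ∩ {z | z ⬝ᵥ η = 0})) :
    orthHyperplane η ∈ facetHyperplanes X :=
  ⟨finrank_orthHyperplane hη, le_antisymm (Submodule.span_le.mpr fun _ hz => hz.2) h⟩

theorem dirDeriv_zero : dirDeriv (0 : Fin n → ℝ) = 0 := by
  have h := dirDeriv_smul (0 : ℝ) (0 : Fin n → ℝ)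
  rwa [zero_smul, Complex.ofReal_zero, zero_smul] at h

/-- Since `X` spans, every nonzero flat normal of the full family is a normal of a facet hyperplane,
so the generators of `I_+` impose the conditions defining `powerKer`. Conversely the degree bound
for products holds along every direction. -/
theorem mem_PPlus_iff_IPlus [Finite ι] {X : ι → Fin n → ℝ}
    (hX : Submodule.span ℝ (Set.range X) = ⊤) {f : Poly n} :
    f ∈ PPlus X ↔ ∀ q ∈ IPlus X, pairing q (toSeries n f) = 0 := by
  classical
  have := Fintype.ofFinite ι
  rw [IPlus, forall_mem_span_pairing_eq_zero, PPlus_eq_prodSpan]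
  constructor
  · rintro hf _ ⟨H, -, η, -, hη, rfl⟩
    rw [diffOp_linForm_pow_toSeries, dirDeriv_pow_eq_zero_of_le ?_ (dirDeriv_pow_prodSpan η hf),
      map_zero]
    refine Nat.succ_le_succ ?_
    rw [nonOrthCount, outsideCount, ← Set.ncard_coe_finset]
    refine Set.ncard_le_ncard (fun i hi hiH => ?_) (Set.toFinite _)
    refine (Finset.mem_filter.mp (Finset.mem_coe.mp hi)).2 ?_
    rw [dotProduct_comm, hη _ hiH]
  · refine fun h => powerKer_le_prodSpan X _ (mem_powerKer.mpr fun η hη => ?_)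
    rcases eq_or_ne η 0 with rfl | h0
    · rw [dirDeriv_zero, zero_pow (Nat.succ_ne_zero _), LinearMap.zero_apply]
    have hcount : outsideCount X (orthHyperplane η) = nonOrthCount X Finset.univ η := by
      rw [nonOrthCount, outsideCount, ← Set.ncard_coe_finset]
      congr 1
      ext i
      simp [mem_orthHyperplane]
    have hfacet : orthHyperplane η ∈ facetHyperplanes X := by
      refine orthHyperplane_mem_facetHyperplanes h0 fun z hz => ?_
      refine Submodule.span_mono ?_ (hη z ?_ hz)
      · rintro _ ⟨y, hy, rfl⟩
        exact ⟨⟨y, rfl⟩, hy.2⟩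
      · rw [Finset.coe_univ, Set.image_univ, hX]; trivial
    have h1 := h _ ⟨_, hfacet, η, h0, fun z hz => by
      rw [dotProduct_comm]; exact mem_orthHyperplane.mp hz, rfl⟩
    rw [diffOp_linForm_pow_toSeries, hcount] at h1
    exact toSeries_injective n (h1.trans (map_zero _).symm)

/-- The facet normals separate points. -/
theorem eq_zero_of_forall_facet_normal {X : ι → Fin n → ℝ}
    (hX : Submodule.span ℝ (Set.range X) = ⊤) {v : Fin n → ℝ}
    (hv : ∀ H ∈ facetHyperplanes X, ∀ η : Fin n → ℝ, η ≠ 0 → (∀ h ∈ H, η ⬝ᵥ h = 0) →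
      η ⬝ᵥ v = 0) : v = 0 := by
  classical
  -- For a basis chosen from `X`, the kernel of each coordinate functional is spanned by the other
  -- basis vectors. Its normal is therefore a facet normal, and `v` has all coordinates zero.
  let b := Module.Basis.ofSpan hX.ge
  have hb : ∀ j, b j ∈ Set.range X := fun j => Module.Basis.ofSpan_subset hX.ge ⟨j, rfl⟩
  refine b.ext_elem fun j => ?_
  obtain ⟨η, hη⟩ := exists_dotProduct_eq (b.coord j)
  rw [map_zero, Finsupp.zero_apply, ← b.coord_apply, ← hη, dotProduct_comm]
  have h0 : η ≠ 0 := by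
    rintro rfl
    have h := hη (b j)
    rw [dotProduct_zero, b.coord_apply, b.repr_self, Finsupp.single_eq_same] at h
    exact zero_ne_one h
  refine hv _ (orthHyperplane_mem_facetHyperplanes h0 fun z hz => ?_) η h0 fun z hz => by
    rw [dotProduct_comm]; exact mem_orthHyperplane.mp hz
  rw [← b.linearCombination_repr z, Finsupp.linearCombination_apply]
  refine Submodule.sum_mem _ fun k _ => ?_
  rcases eq_or_ne k j with rfl | hk
  · rw [hη, b.coord_apply] at hz
    simp only [hz, zero_smul]
    exact zero_mem _
  · refine Submodule.smul_mem _ _ (Submodule.subset_span ⟨hb k, ?_⟩)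
    change b k ⬝ᵥ η = 0
    rw [hη, b.coord_apply, b.repr_self, Finsupp.single_eq_of_ne hk.symm]

theorem map_PPlus_eq_idealKer [Finite ι] {X : ι → Fin n → ℝ}
    (hX : Submodule.span ℝ (Set.range X) = ⊤) :
    (PPlus X).map (toSeries n) = idealKer (IPlus X) := by
  refine idealKer_eq_map (fun q hq => eval_eq_zero_of_mem_span ?_ hq) (fun α hα => ?_)
    fun f => mem_PPlus_iff_IPlus hX
  · rintro _ ⟨H, -, η, -, -, rfl⟩
    rw [map_pow, eval_zero_linForm, zero_pow (Nat.succ_ne_zero _)]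
  · have h : ∀ H ∈ facetHyperplanes X, ∀ η : Fin n → ℝ, η ≠ 0 → (∀ h ∈ H, η ⬝ᵥ h = 0) →
        eval α (linForm η) = 0 := fun H hH η h0 hη => by
      have h1 := hα _ (Ideal.subset_span ⟨H, hH, η, h0, hη, rfl⟩)
      rw [map_pow] at h1
      exact eq_zero_of_pow_eq_zero h1
    exact eq_zero_of_re_im
      (eq_zero_of_forall_facet_normal hX fun H hH η h0 hη =>
        (eval_linForm_eq_zero.mp (h H hH η h0 hη)).1)
      (eq_zero_of_forall_facet_normal hX fun H hH η h0 hη =>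
        (eval_linForm_eq_zero.mp (h H hH η h0 hη)).2)

/-! ## Vertices and dimensions -/

theorem conj_of_mem_externalVertices {X : ι → Fin n → ℝ}
    {B₀ : Module.Basis (Fin n) ℝ (Fin n → ℝ)} {lam : ι ⊕ Fin n → ℝ} {α : Fin n → ℂ}
    (hα : α ∈ externalVertices X B₀ lam) (i : Fin n) : starRingEnd ℂ (α i) = α i := by
  obtain ⟨v, -, rfl⟩ := hα
  exact Complex.conj_ofReal _

/-- Two different external bases have more than `n` members in their union; a shared vertex would
lie on all of those hyperplanes, against genericity. -/
theorem ncard_indepSets_le {X : ι → Fin n → ℝ} {B₀ : Module.Basis (Fin n) ℝ (Fin n → ℝ)}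
    {lam : ι ⊕ Fin n → ℝ} (hlam : IsGeneric (augmented X B₀) lam)
    (hfin : (externalVertices X B₀ lam).Finite) :
    (indepSets X).ncard ≤ Nat.card (externalVertices X B₀ lam) := by
  classical
  choose v hv using fun I : indepSets X => exists_vertex B₀ I.2 lam
  have := hfin.to_subtype
  let φ : indepSets X → externalVertices X B₀ lam := fun I =>
    ⟨fun i => (v I i : ℂ), v I, ⟨_, ⟨I, I.2, rfl⟩, hv I⟩, rfl⟩
  rw [← Nat.card_coe_set_eq]
  refine Nat.card_le_card_of_injective φ fun I I' h => ?_
  have hvv : v I = v I' := funext fun i =>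
    Complex.ofReal_injective (congrFun (congrArg Subtype.val h) i)
  refine Subtype.ext (greedyExt_injective X B₀ ?_)
  by_contra hne
  have hlt : n < (greedyExt X B₀ I ∪ greedyExt X B₀ I').card := by
    refine (card_greedyExt B₀ I.2).symm.trans_lt (Finset.card_lt_card ?_)
    refine (Finset.subset_union_left.ssubset_of_ne fun heq => hne ?_)
    refine (Finset.eq_of_subset_of_card_le (Finset.union_eq_left.mp heq.symm) ?_).symm
    rw [card_greedyExt B₀ I.2, card_greedyExt B₀ I'.2]
  obtain ⟨S, hS, hcard⟩ := Finset.exists_subset_card_eq (Nat.succ_le_of_lt hlt)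
  refine hlam S hcard ⟨v I, fun y hy => ?_⟩
  rcases Finset.mem_union.mp (hS hy) with h | h
  · exact hv I y h
  · rw [hvv]; exact hv I' y h

/-- The chain of inequalities closes up here: `h1`, `h2`, `h3` and `h4` start and end at `(indepSets
X).ncard`. -/
theorem externalVertices_generic [Finite ι] {X : ι → Fin n → ℝ}
    {B₀ : Module.Basis (Fin n) ℝ (Fin n → ℝ)} {lam : ι ⊕ Fin n → ℝ}
    (hlam : IsGeneric (augmented X B₀) lam) :
    (externalVertices X B₀ lam).Finite ∧
      Nat.card (externalVertices X B₀ lam) = (indepSets X).ncard ∧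
      Module.finrank ℂ (DPlus X B₀) = (indepSets X).ncard ∧
      DPlus X B₀ = leastSpace (externalVertices X B₀ lam) := by
  have hle := leastSpace_le_DPlus X B₀ lam
  have := finiteDimensional_DPlus X B₀
  have := Submodule.finiteDimensional_of_le hle
  obtain ⟨hfin, h2⟩ := finite_and_card_le_finrank_leastSpace
    (σ := externalVertices X B₀ lam) fun α hα => conj_of_mem_externalVertices hα
  have h1 := ncard_indepSets_le hlam hfin
  have h3 := Submodule.finrank_mono hle
  have h4 := finrank_DPlus_le X B₀
  rw [finrank_PPlus] at h4
  exact ⟨hfin, by omega, by omega, (Submodule.eq_of_le_of_finrank_eq hle (by omega)).symm⟩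

theorem finrank_DPlus [Finite ι] (X : ι → Fin n → ℝ) (B₀ : Module.Basis (Fin n) ℝ (Fin n → ℝ)) :
    Module.finrank ℂ (DPlus X B₀) = (indepSets X).ncard := by
  obtain ⟨lam, hlam⟩ := exists_isGeneric (augmented X B₀)
  exact (externalVertices_generic hlam).2.2.1

theorem pairingMap_bijective [Finite ι] (X : ι → Fin n → ℝ)
    (B₀ : Module.Basis (Fin n) ℝ (Fin n → ℝ)) :
    Function.Bijective (pairingMap (DPlus X B₀) (PPlus X)) := by
  have := finiteDimensional_DPlus X B₀
  have := finiteDimensional_PPlus X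
  have hinj := pairingLinear_injective X B₀
  have hsurj := (LinearMap.injective_iff_surjective_of_finrank_eq_finrank (by
    rw [finrank_DPlus, Subspace.dual_finrank_eq, finrank_PPlus])).mp hinj
  exact ⟨hinj, hsurj⟩

theorem eq_zero_of_mem_PPlus [Finite ι] {X : ι → Fin n → ℝ}
    {B₀ : Module.Basis (Fin n) ℝ (Fin n → ℝ)} {p : Poly n} (hp : p ∈ PPlus X)
    (h : ∀ f ∈ DPlus X B₀, pairing p (toSeries n f) = 0) : p = 0 := by
  have := finiteDimensional_PPlus X
  have h0 : (⟨p, hp⟩ : PPlus X) = 0 := by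
    refine (Module.forall_dual_apply_eq_zero_iff ℂ _).mp fun φ => ?_
    obtain ⟨f, rfl⟩ := (pairingMap_bijective X B₀).2 φ
    exact (pairing_poly_comm _ _).trans (h f f.2)
  exact congrArg Subtype.val h0

theorem isCompl_PPlus_JPlus [Finite ι] (X : ι → Fin n → ℝ)
    (B₀ : Module.Basis (Fin n) ℝ (Fin n → ℝ)) :
    IsCompl (PPlus X) ((JPlus X B₀).restrictScalars ℂ) :=
  ⟨Submodule.disjoint_def.mpr fun p hp hJ => eq_zero_of_mem_PPlus (B₀ := B₀) hp fun _ hf =>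
    mem_DPlus_iff_JPlus.mp hf p hJ, codisjoint_iff.mpr (PPlus_sup_JPlus X B₀)⟩

theorem isCorrect_DPlus_PPlus [Finite ι] {X : ι → Fin n → ℝ}
    {B₀ : Module.Basis (Fin n) ℝ (Fin n → ℝ)} {lam : ι ⊕ Fin n → ℝ}
    (hlam : IsGeneric (augmented X B₀) lam) :
    IsCorrect (externalVertices X B₀ lam) (DPlus X B₀) ∧
      IsCorrect (externalVertices X B₀ lam) (PPlus X) := by
  obtain ⟨hfin, hcard, hrank, hD⟩ := externalVertices_generic hlam
  have := finiteDimensional_DPlus X B₀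
  have := finiteDimensional_PPlus X
  constructor
  · refine isCorrect_of_finrank_eq hfin (hrank.trans hcard.symm) ?_ fun p hp h => ?_
    · rw [hD]
      exact fun p hp k => homogeneousComponent_mem_leastSpace hp k
    -- `D_+` equals the least space and is stable under conjugation, so `p` may be paired with its
    -- own conjugate.
    · refine eq_zero_of_pairing_conj_self ((pairing_poly_comm _ _).trans (h _ ?_))
      exact conj_mem_leastSpace (fun α hα => conj_of_mem_externalVertices hα) (hD ▸ hp)
  · refine isCorrect_of_finrank_eq hfin ((finrank_PPlus X).trans hcard.symm)
      (fun p hp k => homogeneousComponent_mem_PPlus X hp k) fun p hp h => ?_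
    exact eq_zero_of_mem_PPlus (B₀ := B₀) hp (hD ▸ h)

end

end Zonotopal

theorem mainTheorem1 {n : ℕ} {ι : Type*} [Finite ι] (X : ι → Fin n → ℝ)
    (hX0 : ∀ i, X i ≠ 0) (hX : Submodule.span ℝ (Set.range X) = ⊤)
    (B₀ : Module.Basis (Fin n) ℝ (Fin n → ℝ)) :
    (Module.finrank ℂ (PPlus X) = (indepSets X).ncard ∧
      Module.finrank ℂ (DPlus X B₀) = (indepSets X).ncard) ∧
    Function.Bijective (pairingMap (DPlus X B₀) (PPlus X)) ∧
    ((∀ lam : ι ⊕ Fin n → ℝ, IsGeneric (augmented X B₀) lam →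
        DPlus X B₀ = leastSpace (externalVertices X B₀ lam)) ∧
      (DPlus X B₀).map (toSeries n) = idealKer (JPlus X B₀)) ∧
    (∀ lam : ι ⊕ Fin n → ℝ, IsGeneric (augmented X B₀) lam →
      IsCorrect (externalVertices X B₀ lam) (DPlus X B₀) ∧
      IsCorrect (externalVertices X B₀ lam) (PPlus X)) ∧
    (PPlus X).map (toSeries n) = idealKer (IPlus X) ∧
    IsCompl (PPlus X) ((JPlus X B₀).restrictScalars ℂ) :=
  ⟨⟨finrank_PPlus X, finrank_DPlus X B₀⟩, pairingMap_bijective X B₀,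
    ⟨fun _ hlam => (externalVertices_generic hlam).2.2.2, map_DPlus_eq_idealKer X B₀⟩,
    fun _ hlam => isCorrect_DPlus_PPlus hlam, map_PPlus_eq_idealKer hX,
    isCompl_PPlus_JPlus X B₀⟩
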